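/- **Proposition 3.2.** Let $k$ be a field, let $H$ be a commutative Hopf algebra over $k$ with antipode $S$ (automatically bijective), and let $A$ be a commutative right $H$-comodule algebra, i.e. a commutative $k$-algebra with a right $H$-coaction $\rho(a)=a_0\otimes a_1$ such that $\rho(1)=1\otimes 1$ and $\rho(ab)=a_0b_0\otimes a_1b_1$. Let ${}_A\mathcal M^H$ be the category of relative $(A,H)$-Hopf modules: its objects are the $A$-modules $M$ with a right $H$-coaction $\rho(m)=m_0\otimes m_1$ (over $k$) satisfying $\rho(am)=a_0m_0\otimes a_1m_1$, and its morphisms are the $A$-linear $H$-colinear maps; write ${}_A\mathrm{Hom}^H(M,N)$ for the $k$-vector space of morphisms. This is an abelian category with enough injectives; for $M\in{}_A\mathcal M^H$ let ${}_A\mathrm{Ext}^{H,i}(M,-)$, $i\ge 0$, be the right derived functors of ${}_A\mathrm{Hom}^H(M,-)\colon {}_A\mathcal M^H\to{}_k\mathcal M$. Let $M,N,P\in{}_A\mathcal M^H$, with $N$ finitely generated projective as an $A$-module. Regard $M\otimes_AN$ as an object of ${}_A\mathcal M^H$ by the coaction $\rho(m\otimes n)=m_0\otimes n_0\otimes m_1n_1$,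 and ${}_A\mathrm{Hom}(N,P)$ as an object of ${}_A\mathcal M^H$ by the coaction $f\mapsto f_0\otimes f_1$ determined, through the isomorphism ${}_A\mathrm{Hom}(N,P)\otimes H\cong{}_A\mathrm{Hom}(N,P\otimes H)$, by $$f_0(n)\otimes f_1=f(n_0)_0\otimes S^{-1}(n_1)\,f(n_0)_1\qquad(n\in N).$$ Then for every $i\ge 0$ there is an isomorphism of $k$-vector spaces $${}_A\mathrm{Ext}^{H,i}\bigl(M,{}_A\mathrm{Hom}(N,P)\bigr)\cong{}_A\mathrm{Ext}^{H,i}(M\otimes_AN,P).$$ -/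

import Mathlib

open CategoryTheory CategoryTheory.Limits
open scoped TensorProduct

universe u

noncomputable section

/-- A right comodule `(M, ρ)` over the coalgebra `H`, with coaction
`ρ(m) = m₀ ⊗ m₁ ∈ M ⊗ H`. -/
class RightComodule (k H M : Type*) [CommRing k] [AddCommGroup H] [Module k H] [Coalgebra k H]
    [AddCommGroup M] [Module k M] where
  /-- the coaction `ρ` -/
  coact (k H) : M →ₗ[k] M ⊗[k] H
  coassoc (m : M) : TensorProduct.assoc k M H H (coact.rTensor H (coact m)) =
    (Coalgebra.comul (R := k) (A := H)).lTensor M (coact m)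
  counit (m : M) :
    TensorProduct.rid k M ((Coalgebra.counit (R := k) (A := H)).lTensor M (coact m)) = m

/-- A (commutative) right `H`-comodule algebra: `ρ(1) = 1 ⊗ 1` and `ρ(ab) = a₀b₀ ⊗ a₁b₁`, the
product on the right being that of the algebra `A ⊗ H`. -/
class ComoduleAlgebra (k H A : Type*) [CommRing k] [CommRing H] [Bialgebra k H]
    [CommRing A] [Algebra k A] extends RightComodule k H A where
  coact_one : coact (1 : A) = 1
  coact_mul (a b : A) : coact (a * b) = coact a * coact b

open RightComodule (coact)

section Basic

variable (k H A : Type*) [CommRing k] [CommRing H] [Bialgebra k H] [CommRing A] [Algebra k A]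
variable (M : Type*) [AddCommGroup M] [Module k M] [Module A M] [IsScalarTower k A M]

/-- The `k`-bilinear map `(a ⊗ h, m ⊗ h') ↦ am ⊗ hh'` from `(A ⊗ H) × (M ⊗ H)` to `M ⊗ H`. -/
def diagAct : (A ⊗[k] H) →ₗ[k] (M ⊗[k] H) →ₗ[k] (M ⊗[k] H) :=
  TensorProduct.map₂ (Algebra.lsmul k k M).toLinearMap (LinearMap.mul k H)

@[simp] theorem diagAct_tmul (a : A) (h : H) (m : M) (h' : H) :
    diagAct k H A M (a ⊗ₜ h) (m ⊗ₜ h') = (a • m) ⊗ₜ (h * h') := by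
  simp [diagAct]

theorem diagAct_one (x : M ⊗[k] H) : diagAct k H A M 1 x = x := by
  induction x with
  | zero => simp
  | add x y hx hy => simp only [map_add, hx, hy]
  | tmul m h => simp [Algebra.TensorProduct.one_def]

theorem diagAct_mul (x y : A ⊗[k] H) (z : M ⊗[k] H) :
    diagAct k H A M (x * y) z = diagAct k H A M x (diagAct k H A M y z) := by
  induction x with
  | zero => simp
  | add x x' hx hx' => simp only [add_mul, map_add, LinearMap.add_apply, hx, hx']
  | tmul a h =>
    induction y with
    | zero => simp
    | add y y' hy hy' => simp only [mul_add, map_add, LinearMap.add_apply, hy, hy']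
    | tmul b h' =>
      induction z with
      | zero => simp
      | add z z' hz hz' => simp only [map_add, hz, hz']
      | tmul m h'' => simp [mul_smul, mul_assoc]

/-- The compatibility condition `ρ(am) = a₀m₀ ⊗ a₁m₁` between the action of the comodule algebra
`A` and the coaction of `H` on a relative `(A, H)`-Hopf module. -/
class IsRelHopf [ComoduleAlgebra k H A] [RightComodule k H M] : Prop where
  coact_smul (a : A) (m : M) :
    coact k H (a • m) = diagAct k H A M (coact k H a) (coact k H m)

end Basic

section Antipode

variable (k H : Type*) [CommRing k] [CommRing H] [HopfAlgebra k H]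

theorem antipode_antipode' (h : H) :
    HopfAlgebra.antipode k (HopfAlgebra.antipode k h) = h := by
  have h1 : (WithConv.toConv ((HopfAlgebra.antipodeAlgHom k H).comp
      (HopfAlgebra.antipodeAlgHom k H)) : WithConv (H →ₐ[k] H)) =
      WithConv.toConv (AlgHom.id k H) := by
    have e : (WithConv.toConv (HopfAlgebra.antipodeAlgHom k H) : WithConv (H →ₐ[k] H)) =
      (WithConv.toConv (AlgHom.id k H))⁻¹ := rfl
    have e2 : (WithConv.toConv ((HopfAlgebra.antipodeAlgHom k H).comp
      (HopfAlgebra.antipodeAlgHom k H)) : WithConv (H →ₐ[k] H)) =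
      (WithConv.toConv (HopfAlgebra.antipodeAlgHom k H))⁻¹ := rfl
    rw [e2, e, inv_inv]
  exact congr(WithConv.ofConv $h1 h)

/-- The antipode of a commutative Hopf algebra as a bijection. -/
def antipodeEquiv : H ≃ₗ[k] H :=
  LinearEquiv.ofLinearMap (HopfAlgebra.antipode k) (HopfAlgebra.antipode k)
    (LinearMap.ext (antipode_antipode' k H)) (LinearMap.ext (antipode_antipode' k H))

@[simp] theorem antipodeEquiv_apply (h : H) : antipodeEquiv k H h = HopfAlgebra.antipode k h := rfl

@[simp] theorem antipodeEquiv_symm_apply (h : H) :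
    (antipodeEquiv k H).symm h = HopfAlgebra.antipode k h := rfl

theorem comul_antipode' (h : H) : Coalgebra.comul (R := k) (HopfAlgebra.antipode k h) =
    TensorProduct.map (HopfAlgebra.antipode k) (HopfAlgebra.antipode k)
      (TensorProduct.comm k H H (Coalgebra.comul (R := k) h)) := by
  let i₁ : WithConv (H →ₐ[k] H ⊗[k] H) :=
    WithConv.toConv (Algebra.TensorProduct.includeLeft : H →ₐ[k] H ⊗[k] H)
  let i₂ : WithConv (H →ₐ[k] H ⊗[k] H) :=
    WithConv.toConv (Algebra.TensorProduct.includeRight : H →ₐ[k] H ⊗[k] H)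
  have hΔ : (WithConv.toConv (Bialgebra.comulAlgHom k H) : WithConv (H →ₐ[k] H ⊗[k] H)) =
      i₁ * i₂ := by
    ext x
    rw [AlgHom.convMul_apply]
    change Coalgebra.comul (R := k) x = _
    induction Coalgebra.comul (R := k) x with
    | zero => simp
    | add x y hx hy => rw [map_add, ← hx, ← hy]
    | tmul a b => simp [i₁, i₂]
  have h1 : (WithConv.toConv (Bialgebra.comulAlgHom k H) : WithConv (H →ₐ[k] H ⊗[k] H))⁻¹ h =
      (i₂⁻¹ * i₁⁻¹ : WithConv (H →ₐ[k] H ⊗[k] H)) h := by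
    rw [hΔ]
    exact congr(WithConv.ofConv $(mul_inv_rev i₁ i₂) h)
  refine h1.trans ?_
  rw [AlgHom.convMul_apply]
  induction Coalgebra.comul (R := k) h with
  | zero => simp
  | add x y hx hy => rw [map_add, hx, hy, map_add, map_add]
  | tmul a b =>
    have e1 (x : H) : (i₁⁻¹).ofConv x = HopfAlgebra.antipode k x ⊗ₜ[k] (1 : H) := rfl
    have e2 (x : H) : (i₂⁻¹).ofConv x = (1 : H) ⊗ₜ[k] HopfAlgebra.antipode k x := rfl
    simp [e1, e2]

end Antipode

section Transport

variable {k H : Type*} [CommRing k] [CommRing H] [Bialgebra k H]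
variable {M N : Type*} [AddCommGroup M] [Module k M] [AddCommGroup N] [Module k N]

theorem assoc_rTensor (f : M →ₗ[k] N) (y : (M ⊗[k] H) ⊗[k] H) :
    f.rTensor (H ⊗[k] H) (TensorProduct.assoc k M H H y) =
      TensorProduct.assoc k N H H ((f.rTensor H).rTensor H y) := by
  have : f.rTensor (H ⊗[k] H) ∘ₗ (TensorProduct.assoc k M H H).toLinearMap =
      (TensorProduct.assoc k N H H).toLinearMap ∘ₗ (f.rTensor H).rTensor H := by
    ext; simp
  exact congr($this y)

theorem rid_rTensor (f : M →ₗ[k] N) (y : M ⊗[k] k) :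
    f (TensorProduct.rid k M y) = TensorProduct.rid k N (f.rTensor k y) := by
  have : f ∘ₗ (TensorProduct.rid k M).toLinearMap =
      (TensorProduct.rid k N).toLinearMap ∘ₗ f.rTensor k := by
    ext; simp
  exact congr($this y)

theorem coassoc_of_map [RightComodule k H M] (r : N →ₗ[k] N ⊗[k] H) (f : M →ₗ[k] N)
    (h : r ∘ₗ f = f.rTensor H ∘ₗ coact k H) (x : M) :
    TensorProduct.assoc k N H H (r.rTensor H (r (f x))) =
      (Coalgebra.comul (R := k) (A := H)).lTensor N (r (f x)) := by
  rw [← LinearMap.comp_apply _ f, h, LinearMap.comp_apply (f.rTensor H),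
    ← LinearMap.comp_apply _ (f.rTensor H), ← LinearMap.rTensor_comp, h,
    LinearMap.rTensor_comp, LinearMap.comp_apply, ← assoc_rTensor, RightComodule.coassoc,
    ← LinearMap.comp_apply (f.rTensor _), LinearMap.rTensor_comp_lTensor,
    ← LinearMap.lTensor_comp_rTensor, LinearMap.comp_apply]

theorem counit_of_map [RightComodule k H M] (r : N →ₗ[k] N ⊗[k] H) (f : M →ₗ[k] N)
    (h : r ∘ₗ f = f.rTensor H ∘ₗ coact k H) (x : M) :
    TensorProduct.rid k N ((Coalgebra.counit (R := k) (A := H)).lTensor N (r (f x))) = f x := by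
  rw [← LinearMap.comp_apply _ f, h, LinearMap.comp_apply (f.rTensor H),
    ← LinearMap.comp_apply _ (f.rTensor H), LinearMap.lTensor_comp_rTensor,
    ← LinearMap.rTensor_comp_lTensor, LinearMap.comp_apply, ← rid_rTensor, RightComodule.counit]

end Transport

section SubQuot

variable {k H : Type*} [Field k] [CommRing H] [Bialgebra k H]
variable {K M : Type*} [AddCommGroup K] [Module k K] [AddCommGroup M] [Module k M]

/-- The coaction induced on a subspace `i : K ↪ M` with `ρ(i(K)) ⊆ i(K) ⊗ H`; it is the unique one
for which `i` is colinear. -/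
abbrev RightComodule.sub [RightComodule k H M] (i : K →ₗ[k] M) (hi : Function.Injective i)
    (h : ∀ x, coact k H (i x) ∈ LinearMap.range (i.rTensor H)) : RightComodule k H K :=
  let r := (i.exists_leftInverse_of_injective (LinearMap.ker_eq_bot.2 hi)).choose
  have hr : r ∘ₗ i = LinearMap.id :=
    (i.exists_leftInverse_of_injective (LinearMap.ker_eq_bot.2 hi)).choose_spec
  have key (x : K) : i.rTensor H (r.rTensor H (coact k H (i x))) = coact k H (i x) := by
    obtain ⟨y, hy⟩ := h x
    rw [← hy, ← LinearMap.comp_apply (r.rTensor H), ← LinearMap.rTensor_comp, hr]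
    simp
  have inj (V : Type _) [AddCommGroup V] [Module k V] : Function.Injective (i.rTensor V) := by
    refine Function.LeftInverse.injective (g := r.rTensor V) fun x => ?_
    rw [← LinearMap.comp_apply, ← LinearMap.rTensor_comp, hr]
    simp
  { coact := r.rTensor H ∘ₗ coact k H ∘ₗ i
    coassoc := fun x => by
      apply inj (H ⊗[k] H)
      have hk : (i.rTensor H) ∘ₗ (r.rTensor H ∘ₗ coact k H ∘ₗ i) = coact k H ∘ₗ i :=
        LinearMap.ext key
      rw [assoc_rTensor, ← LinearMap.comp_apply, ← LinearMap.rTensor_comp, hk, LinearMap.rTensor_comp,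
        LinearMap.comp_apply, LinearMap.comp_apply (r.rTensor H), LinearMap.comp_apply, key,
        RightComodule.coassoc, ← LinearMap.comp_apply (i.rTensor _), LinearMap.rTensor_comp_lTensor,
        ← LinearMap.lTensor_comp_rTensor, LinearMap.comp_apply, key]
    counit := fun x => by
      apply hi
      rw [rid_rTensor, ← LinearMap.comp_apply (i.rTensor _), LinearMap.rTensor_comp_lTensor,
        ← LinearMap.lTensor_comp_rTensor, LinearMap.comp_apply, LinearMap.comp_apply,
        LinearMap.comp_apply, key, RightComodule.counit] }

theorem RightComodule.sub_coact [RightComodule k H M] (i : K →ₗ[k] M) (hi : Function.Injective i)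
    (h : ∀ x, coact k H (i x) ∈ LinearMap.range (i.rTensor H)) (x : K) :
    letI := RightComodule.sub i hi h
    i.rTensor H (coact k H x) = coact k H (i x) := by
  set r := (i.exists_leftInverse_of_injective (LinearMap.ker_eq_bot.2 hi)).choose with hr'
  have hr : r ∘ₗ i = LinearMap.id :=
    (i.exists_leftInverse_of_injective (LinearMap.ker_eq_bot.2 hi)).choose_spec
  obtain ⟨y, hy⟩ := h x
  change i.rTensor H (r.rTensor H (coact k H (i x))) = _
  rw [← hy, ← LinearMap.comp_apply (r.rTensor H), ← LinearMap.rTensor_comp, hr]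
  simp

/-- The coaction induced on a quotient `p : M ↠ K` with `ρ(ker p) ⊆ ker (p ⊗ H)`; it is the unique
one for which `p` is colinear. -/
abbrev RightComodule.quot [RightComodule k H M] (p : M →ₗ[k] K) (hp : Function.Surjective p)
    (h : ∀ x, p x = 0 → p.rTensor H (coact k H x) = 0) : RightComodule k H K :=
  let s := (p.exists_rightInverse_of_surjective (LinearMap.range_eq_top.2 hp)).choose
  have hs : p ∘ₗ s = LinearMap.id :=
    (p.exists_rightInverse_of_surjective (LinearMap.range_eq_top.2 hp)).choose_spec
  have key : (p.rTensor H ∘ₗ coact k H ∘ₗ s) ∘ₗ p = p.rTensor H ∘ₗ coact k H := by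
    ext x
    have h1 := h (s (p x) - x) (by rw [map_sub, sub_eq_zero]; exact congr($hs (p x)))
    rw [map_sub, map_sub, sub_eq_zero] at h1
    exact h1
  { coact := p.rTensor H ∘ₗ coact k H ∘ₗ s
    coassoc := fun x => by
      obtain ⟨x, rfl⟩ := hp x
      exact coassoc_of_map _ p key x
    counit := fun x => by
      obtain ⟨x, rfl⟩ := hp x
      exact counit_of_map _ p key x }

theorem RightComodule.quot_coact [RightComodule k H M] (p : M →ₗ[k] K)
    (hp : Function.Surjective p) (h : ∀ x, p x = 0 → p.rTensor H (coact k H x) = 0) (x : M) :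
    letI := RightComodule.quot p hp h
    coact k H (p x) = p.rTensor H (coact k H x) := by
  have hs := (p.exists_rightInverse_of_surjective (LinearMap.range_eq_top.2 hp)).choose_spec
  change p.rTensor H (coact k H (_)) = _
  rw [← sub_eq_zero, ← map_sub, ← map_sub]
  apply h
  rw [map_sub, sub_eq_zero]
  exact congr($hs (p x))

end SubQuot

section Prod

variable (k H : Type*) [CommRing k] [CommRing H] [Bialgebra k H]
variable (M N : Type*) [AddCommGroup M] [Module k M] [AddCommGroup N] [Module k N]
variable [RightComodule k H M] [RightComodule k H N]

/-- The coaction on `M ⊕ N`. -/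
def prodCoact : M × N →ₗ[k] (M × N) ⊗[k] H :=
  (LinearMap.inl k M N).rTensor H ∘ₗ coact k H ∘ₗ LinearMap.fst k M N +
    (LinearMap.inr k M N).rTensor H ∘ₗ coact k H ∘ₗ LinearMap.snd k M N

theorem prodCoact_inl : prodCoact k H M N ∘ₗ LinearMap.inl k M N =
    (LinearMap.inl k M N).rTensor H ∘ₗ coact k H := by
  ext; simp [prodCoact]

theorem prodCoact_inr : prodCoact k H M N ∘ₗ LinearMap.inr k M N =
    (LinearMap.inr k M N).rTensor H ∘ₗ coact k H := by
  ext; simp [prodCoact]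

theorem prodCoact_fst : (LinearMap.fst k M N).rTensor H ∘ₗ prodCoact k H M N =
    coact k H ∘ₗ LinearMap.fst k M N := by
  have h_inl : (LinearMap.fst k M N).rTensor H ∘ₗ (LinearMap.inl k M N).rTensor H = LinearMap.id := by
    rw [← LinearMap.rTensor_comp, LinearMap.fst_comp_inl, LinearMap.rTensor_id]
  have h_inr : (LinearMap.fst k M N).rTensor H ∘ₗ (LinearMap.inr k M N).rTensor H = 0 := by
    rw [← LinearMap.rTensor_comp, LinearMap.fst_comp_inr, LinearMap.rTensor_zero]
  refine LinearMap.ext fun x =>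
    (map_add ((LinearMap.fst k M N).rTensor H) _ _).trans ((congrArg₂ (· + ·)
    (LinearMap.congr_fun h_inl _) (LinearMap.congr_fun h_inr _)).trans ?_)
  simp

theorem prodCoact_snd : (LinearMap.snd k M N).rTensor H ∘ₗ prodCoact k H M N =
    coact k H ∘ₗ LinearMap.snd k M N := by
  have h_inl : (LinearMap.snd k M N).rTensor H ∘ₗ (LinearMap.inl k M N).rTensor H = 0 := by
    rw [← LinearMap.rTensor_comp, LinearMap.snd_comp_inl, LinearMap.rTensor_zero]
  have h_inr : (LinearMap.snd k M N).rTensor H ∘ₗ (LinearMap.inr k M N).rTensor H = LinearMap.id := by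
    rw [← LinearMap.rTensor_comp, LinearMap.snd_comp_inr, LinearMap.rTensor_id]
  refine LinearMap.ext fun x =>
    (map_add ((LinearMap.snd k M N).rTensor H) _ _).trans ((congrArg₂ (· + ·)
    (LinearMap.congr_fun h_inl _) (LinearMap.congr_fun h_inr _)).trans ?_)
  simp

/-- The direct sum of two comodules. -/
abbrev RightComodule.prod : RightComodule k H (M × N) where
  coact := prodCoact k H M N
  coassoc x := by
    have hx : LinearMap.inl k M N x.1 + LinearMap.inr k M N x.2 = x := by ext <;> simp
    have h1 := coassoc_of_map _ _ (prodCoact_inl k H M N) x.1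
    have h2 := coassoc_of_map _ _ (prodCoact_inr k H M N) x.2
    have h3 := congrArg₂ (· + ·) h1 h2
    simpa only [← map_add, hx] using h3
  counit x := by
    have hx : LinearMap.inl k M N x.1 + LinearMap.inr k M N x.2 = x := by ext <;> simp
    have h1 := counit_of_map _ _ (prodCoact_inl k H M N) x.1
    have h2 := counit_of_map _ _ (prodCoact_inr k H M N) x.2
    have h3 := congrArg₂ (· + ·) h1 h2
    simpa only [← map_add, hx] using h3

end Prod

section TensorA

variable (k H A : Type*) [CommRing k] [CommRing H] [Bialgebra k H] [CommRing A] [Algebra k A]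
variable (M N : Type*) [AddCommGroup M] [Module k M] [Module A M] [IsScalarTower k A M]
  [AddCommGroup N] [Module k N] [Module A N] [IsScalarTower k A N]

/-- The `k`-bilinear map `(m ⊗ h, n ⊗ h') ↦ (m ⊗ n) ⊗ hh'` from `(M ⊗ H) × (N ⊗ H)` to
`(M ⊗_A N) ⊗ H`. -/
def tensorMul : (M ⊗[k] H) →ₗ[k] (N ⊗[k] H) →ₗ[k] ((M ⊗[A] N) ⊗[k] H) :=
  TensorProduct.map₂ ((TensorProduct.mk A M N).restrictScalars₁₂ k k) (LinearMap.mul k H)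

@[simp] theorem tensorMul_tmul (m : M) (h : H) (n : N) (h' : H) :
    tensorMul k H A M N (m ⊗ₜ h) (n ⊗ₜ h') = (m ⊗ₜ[A] n) ⊗ₜ[k] (h * h') := by
  simp [tensorMul]

theorem tensorMul_diagAct (x : A ⊗[k] H) (y : M ⊗[k] H) (z : N ⊗[k] H) :
    tensorMul k H A M N (diagAct k H A M x y) z =
      diagAct k H A (M ⊗[A] N) x (tensorMul k H A M N y z) := by
  induction x with
  | zero => simp
  | add x x' hx hx' => simp only [map_add, LinearMap.add_apply, hx, hx']
  | tmul a h =>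
    induction y with
    | zero => simp
    | add y y' hy hy' => simp only [map_add, LinearMap.add_apply, hy, hy']
    | tmul m h' =>
      induction z with
      | zero => simp
      | add z z' hz hz' => simp only [map_add, hz, hz']
      | tmul n h'' => simp [TensorProduct.smul_tmul', mul_assoc]

theorem tensorMul_diagAct' (x : A ⊗[k] H) (y : M ⊗[k] H) (z : N ⊗[k] H) :
    tensorMul k H A M N (diagAct k H A M x y) z =
      tensorMul k H A M N y (diagAct k H A N x z) := by
  induction x with
  | zero => simp
  | add x x' hx hx' => simp only [map_add, LinearMap.add_apply, hx, hx']
  | tmul a h =>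
    induction y with
    | zero => simp
    | add y y' hy hy' => simp only [map_add, LinearMap.add_apply, hy, hy']
    | tmul m h' =>
      induction z with
      | zero => simp
      | add z z' hz hz' => simp only [map_add, hz, hz']
      | tmul n h'' =>
        simp only [diagAct_tmul, tensorMul_tmul, TensorProduct.smul_tmul]
        congr 1
        ring

variable {M N} in
theorem comul_tensorMul (x : M ⊗[k] H) (y : N ⊗[k] H) :
    (Coalgebra.comul (R := k) (A := H)).lTensor _ (tensorMul k H A M N x y) =
      TensorProduct.assoc k _ H H
      (TensorProduct.map₂ (tensorMul k H A M N) (LinearMap.mul k H)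
        ((TensorProduct.assoc k M H H).symm ((Coalgebra.comul (R := k) (A := H)).lTensor _ x))
        ((TensorProduct.assoc k N H H).symm
          ((Coalgebra.comul (R := k) (A := H)).lTensor _ y))) := by
  induction x with
  | zero => simp
  | add x x' hx hx' => simp only [map_add, LinearMap.add_apply, hx, hx']
  | tmul m h =>
    induction y with
    | zero => simp
    | add y y' hy hy' => simp only [map_add, hy, hy']
    | tmul n h' =>
      simp only [tensorMul_tmul, LinearMap.lTensor_tmul, Bialgebra.comul_mul]
      generalize Coalgebra.comul (R := k) h = c
      generalize Coalgebra.comul (R := k) h' = d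
      induction c with
      | zero => simp
      | add c c' hc hc' =>
        simp only [add_mul, TensorProduct.tmul_add, map_add, LinearMap.add_apply, hc, hc']
      | tmul c c' =>
        induction d with
        | zero => simp
        | add d d' hd hd' => simp only [mul_add, TensorProduct.tmul_add, map_add, hd, hd']
        | tmul d d' => simp

variable {M N} in
theorem counit_tensorMul (x : M ⊗[k] H) (y : N ⊗[k] H) :
    TensorProduct.rid k _
      ((Coalgebra.counit (R := k) (A := H)).lTensor _ (tensorMul k H A M N x y)) =
      (TensorProduct.rid k _ ((Coalgebra.counit (R := k) (A := H)).lTensor _ x)) ⊗ₜ[A]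
      (TensorProduct.rid k _ ((Coalgebra.counit (R := k) (A := H)).lTensor _ y)) := by
  induction x with
  | zero => simp
  | add x x' hx hx' => simp only [map_add, LinearMap.add_apply, hx, hx', TensorProduct.add_tmul]
  | tmul m h =>
    induction y with
    | zero => simp
    | add y y' hy hy' => simp only [map_add, hy, hy', TensorProduct.tmul_add]
    | tmul n h' =>
      simp only [tensorMul_tmul, LinearMap.lTensor_tmul, Bialgebra.counit_mul,
        TensorProduct.rid_tmul, mul_smul]
      rw [← TensorProduct.smul_tmul', TensorProduct.tmul_smul]

variable [ComoduleAlgebra k H A] [RightComodule k H M] [RightComodule k H N]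
  [IsRelHopf k H A M] [IsRelHopf k H A N]

/-- The coaction `m ⊗ n ↦ m₀ ⊗ n₀ ⊗ m₁n₁` on `M ⊗_A N`. -/
def tensorCoact : M ⊗[A] N →ₗ[k] (M ⊗[A] N) ⊗[k] H :=
  let f : M ⊗[A] N →+ (M ⊗[A] N) ⊗[k] H := TensorProduct.liftAddHom
    { toFun := fun m =>
        ((tensorMul k H A M N (coact k H m)) ∘ₗ (coact k H : N →ₗ[k] _)).toAddMonoidHom
      map_zero' := by ext; simp
      map_add' := fun m m' => by ext; simp }
    (fun a m n => by
      change tensorMul k H A M N (coact k H (a • m)) (coact k H n) =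
        tensorMul k H A M N (coact k H m) (coact k H (a • n))
      rw [IsRelHopf.coact_smul, IsRelHopf.coact_smul, tensorMul_diagAct'])
  { f with
    map_smul' := fun c x => by
      change f (c • x) = c • f x
      induction x with
      | zero => simp
      | add x y hx hy => rw [smul_add, map_add, hx, hy, map_add, smul_add]
      | tmul m n =>
        change tensorMul k H A M N (coact k H (c • m)) (coact k H n) =
          c • tensorMul k H A M N (coact k H m) (coact k H n)
        simp }

theorem tensorCoact_tmul (m : M) (n : N) : tensorCoact k H A M N (m ⊗ₜ[A] n) =
    tensorMul k H A M N (coact k H m) (coact k H n) := rfl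

variable {M N} in
theorem tensorCoact_rTensor (x : M ⊗[k] H) (y : N ⊗[k] H) :
    (tensorCoact k H A M N).rTensor H (tensorMul k H A M N x y) =
      TensorProduct.map₂ (tensorMul k H A M N) (LinearMap.mul k H)
        ((coact k H).rTensor H x) ((coact k H).rTensor H y) := by
  induction x with
  | zero => simp
  | add x x' hx hx' => simp only [map_add, LinearMap.add_apply, hx, hx']
  | tmul m h =>
    induction y with
    | zero => simp
    | add y y' hy hy' => simp only [map_add, hy, hy']
    | tmul n h' => simp [tensorCoact_tmul]

/-- The `H`-comodule `M ⊗_A N`. -/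
abbrev RightComodule.tensor : RightComodule k H (M ⊗[A] N) where
  coact := tensorCoact k H A M N
  coassoc x := by
    induction x with
    | zero => simp
    | add x y hx hy => simp only [map_add, hx, hy]
    | tmul m n =>
      rw [tensorCoact_tmul, tensorCoact_rTensor, comul_tensorMul, ← RightComodule.coassoc,
        ← RightComodule.coassoc, LinearEquiv.symm_apply_apply, LinearEquiv.symm_apply_apply]
  counit x := by
    induction x with
    | zero => simp
    | add x y hx hy => simp only [map_add, hx, hy]
    | tmul m n =>
      rw [tensorCoact_tmul, counit_tensorMul, RightComodule.counit, RightComodule.counit]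

theorem isRelHopf_tensor :
    letI := RightComodule.tensor k H A M N
    IsRelHopf k H A (M ⊗[A] N) := by
  let _ := RightComodule.tensor k H A M N
  refine ⟨fun a x => ?_⟩
  change tensorCoact k H A M N (a • x) = diagAct k H A _ (coact k H a) (tensorCoact k H A M N x)
  induction x with
  | zero => simp
  | add x y hx hy => rw [smul_add, map_add, hx, hy, map_add, map_add]
  | tmul m n =>
    rw [TensorProduct.smul_tmul', tensorCoact_tmul, tensorCoact_tmul, IsRelHopf.coact_smul,
      tensorMul_diagAct]

end TensorA

section Cofree

variable (k H A V : Type*) [CommRing k] [CommRing H] [Bialgebra k H] [CommRing A] [Algebra k A]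
  [AddCommGroup V] [Module k V] [Module A V] [IsScalarTower k A V]

/-- The coaction `v ⊗ h ↦ v ⊗ h₁ ⊗ h₂` on `V ⊗ H`. -/
abbrev RightComodule.cofree : RightComodule k H (V ⊗[k] H) where
  coact := (TensorProduct.assoc k V H H).symm.toLinearMap ∘ₗ
    (Coalgebra.comul (R := k) (A := H)).lTensor V
  coassoc x := by
    induction x with
    | zero => simp
    | add x y hx hy => simp only [map_add, hx, hy]
    | tmul v h =>
      have e1 (c : H ⊗[k] H) : TensorProduct.assoc k (V ⊗[k] H) H H
          (((TensorProduct.assoc k V H H).symm.toLinearMap ∘ₗ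
            (Coalgebra.comul (R := k) (A := H)).lTensor V).rTensor H
              ((TensorProduct.assoc k V H H).symm (v ⊗ₜ[k] c))) =
          (TensorProduct.assoc k V H (H ⊗[k] H)).symm (v ⊗ₜ[k] (TensorProduct.assoc k H H H
            ((Coalgebra.comul (R := k) (A := H)).rTensor H c))) := by
        induction c with
        | zero => simp
        | add x y hx hy => simp only [map_add, TensorProduct.tmul_add, hx, hy]
        | tmul a b =>
          simp only [TensorProduct.assoc_symm_tmul, LinearMap.rTensor_tmul, LinearMap.comp_apply,
            LinearMap.lTensor_tmul, LinearEquiv.coe_coe]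
          induction Coalgebra.comul (R := k) a with
          | zero => simp
          | add x y hx hy => simp only [map_add, TensorProduct.tmul_add, TensorProduct.add_tmul,
              hx, hy]
          | tmul a b => simp
      have e2 (c : H ⊗[k] H) : (Coalgebra.comul (R := k) (A := H)).lTensor (V ⊗[k] H)
          ((TensorProduct.assoc k V H H).symm (v ⊗ₜ[k] c)) =
          (TensorProduct.assoc k V H (H ⊗[k] H)).symm (v ⊗ₜ[k]
            ((Coalgebra.comul (R := k) (A := H)).lTensor H c)) := by
        induction c with
        | zero => simp
        | add x y hx hy => simp only [map_add, TensorProduct.tmul_add, hx, hy]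
        | tmul a b => simp
      simp only [LinearMap.comp_apply, LinearMap.lTensor_tmul, LinearEquiv.coe_coe]
      refine (e1 _).trans (Eq.trans ?_ (e2 _).symm)
      rw [Coalgebra.coassoc_apply]
  counit x := by
    induction x with
    | zero => simp
    | add x y hx hy => simp only [map_add, hx, hy]
    | tmul v h =>
      have e1 (c : H ⊗[k] H) : TensorProduct.rid k (V ⊗[k] H)
          ((Coalgebra.counit (R := k) (A := H)).lTensor (V ⊗[k] H)
          ((TensorProduct.assoc k V H H).symm (v ⊗ₜ[k] c))) =
          v ⊗ₜ[k] TensorProduct.rid k H ((Coalgebra.counit (R := k) (A := H)).lTensor H c) := by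
        induction c with
        | zero => simp
        | add x y hx hy => simp only [map_add, TensorProduct.tmul_add, hx, hy]
        | tmul a b => simp
      simp only [LinearMap.comp_apply, LinearMap.lTensor_tmul, LinearEquiv.coe_coe]
      refine (e1 _).trans ?_
      rw [Coalgebra.lTensor_counit_comul]
      simp

/-- The cofree relative Hopf module `V ⊗ H` on an `A`-module `V`, with action
`a(v ⊗ h) = a₀v ⊗ a₁h` and coaction `v ⊗ h ↦ v ⊗ h₁ ⊗ h₂`. -/
def Cofree : Type _ := V ⊗[k] H

instance : AddCommGroup (Cofree k H V) := inferInstanceAs (AddCommGroup (V ⊗[k] H))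
instance : Module k (Cofree k H V) := inferInstanceAs (Module k (V ⊗[k] H))

theorem comul_diagAct (x : A ⊗[k] H) (y : V ⊗[k] H) :
    (Coalgebra.comul (R := k) (A := H)).lTensor V (diagAct k H A V x y) =
      TensorProduct.assoc k V H H (TensorProduct.map₂ (diagAct k H A V) (LinearMap.mul k H)
        ((TensorProduct.assoc k A H H).symm ((Coalgebra.comul (R := k) (A := H)).lTensor A x))
        ((TensorProduct.assoc k V H H).symm
          ((Coalgebra.comul (R := k) (A := H)).lTensor V y))) := by
  induction x with
  | zero => simp
  | add x x' hx hx' => simp only [map_add, LinearMap.add_apply, hx, hx']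
  | tmul m h =>
    induction y with
    | zero => simp
    | add y y' hy hy' => simp only [map_add, hy, hy']
    | tmul n h' =>
      simp only [diagAct_tmul, LinearMap.lTensor_tmul, Bialgebra.comul_mul]
      generalize Coalgebra.comul (R := k) h = c
      generalize Coalgebra.comul (R := k) h' = d
      induction c with
      | zero => simp
      | add c c' hc hc' =>
        simp only [add_mul, TensorProduct.tmul_add, map_add, LinearMap.add_apply, hc, hc']
      | tmul c c' =>
        induction d with
        | zero => simp
        | add d d' hd hd' => simp only [mul_add, TensorProduct.tmul_add, map_add, hd, hd']
        | tmul d d' => simp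

variable [ComoduleAlgebra k H A]

instance : Module A (Cofree k H V) where
  smul a x := diagAct k H A V (coact k H a) x
  one_smul := fun (x : V ⊗[k] H) => by
    change diagAct k H A V (coact k H (1 : A)) x = x
    rw [ComoduleAlgebra.coact_one, diagAct_one]
  mul_smul a b := fun (x : V ⊗[k] H) => by
    change diagAct k H A V (coact k H (a * b)) x =
      diagAct k H A V (coact k H a) (diagAct k H A V (coact k H b) x)
    rw [ComoduleAlgebra.coact_mul, diagAct_mul]
  smul_zero a := map_zero (diagAct k H A V (coact k H a))
  smul_add a := map_add (diagAct k H A V (coact k H a))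
  add_smul a b := fun (x : V ⊗[k] H) => by
    change diagAct k H A V (coact k H (a + b)) x =
      diagAct k H A V (coact k H a) x + diagAct k H A V (coact k H b) x
    rw [map_add, map_add, LinearMap.add_apply]
  zero_smul := fun (x : V ⊗[k] H) => by
    change diagAct k H A V (coact k H (0 : A)) x = 0
    rw [map_zero, map_zero, LinearMap.zero_apply]

theorem Cofree.smul_def (a : A) (x : V ⊗[k] H) :
    (a • (show Cofree k H V from x) : Cofree k H V) = diagAct k H A V (coact k H a) x := rfl

instance : IsScalarTower k A (Cofree k H V) where
  smul_assoc c a := fun (x : V ⊗[k] H) => by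
    change diagAct k H A V (coact k H (c • a)) x = c • diagAct k H A V (coact k H a) x
    rw [map_smul, map_smul, LinearMap.smul_apply]

instance : RightComodule k H (Cofree k H V) := RightComodule.cofree k H V

theorem diagAct_cofree (x : A ⊗[k] H) (y : (V ⊗[k] H) ⊗[k] H) :
    diagAct k H A (Cofree k H V) x y =
      TensorProduct.map₂ (diagAct k H A V) (LinearMap.mul k H)
        ((coact k H : A →ₗ[k] _).rTensor H x) y := by
  have : diagAct k H A (Cofree k H V) =
      (show A ⊗[k] H →ₗ[k] (Cofree k H V ⊗[k] H) →ₗ[k] (Cofree k H V ⊗[k] H) from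
        TensorProduct.map₂ (diagAct k H A V) (LinearMap.mul k H) ∘ₗ
          (coact k H : A →ₗ[k] _).rTensor H) :=
    TensorProduct.ext' fun a h => TensorProduct.ext' fun v h' =>
      (diagAct_tmul k H A (Cofree k H V) a h v h')
  exact congr($this x y)

instance : IsRelHopf k H A (Cofree k H V) where
  coact_smul a := fun (x : V ⊗[k] H) => by
    refine Eq.trans ?_ (diagAct_cofree k H A V _ _).symm
    change (TensorProduct.assoc k V H H).symm ((Coalgebra.comul (R := k) (A := H)).lTensor V
      (diagAct k H A V (coact k H a) x)) = TensorProduct.map₂ _ _ _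
        ((TensorProduct.assoc k V H H).symm ((Coalgebra.comul (R := k) (A := H)).lTensor V x))
    rw [comul_diagAct, LinearEquiv.symm_apply_apply, ← RightComodule.coassoc,
      LinearEquiv.symm_apply_apply]

end Cofree

section EvalHom

variable (k A : Type*) [CommRing k] [CommRing A] [Algebra k A]
variable (N P W : Type*) [AddCommGroup N] [Module k N] [Module A N] [IsScalarTower k A N]
  [AddCommGroup P] [Module k P] [Module A P] [IsScalarTower k A P]
  [AddCommGroup W] [Module k W]

/-- The natural map `Hom_A(N, P) ⊗ W → Hom_A(N, P ⊗ W)`, `f ⊗ w ↦ (n ↦ f(n) ⊗ w)`. -/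
def evalHom : (N →ₗ[A] P) ⊗[k] W →ₗ[k] (N →ₗ[A] P ⊗[k] W) :=
  TensorProduct.lift (LinearMap.mk₂ k
    (fun f w => ((TensorProduct.AlgebraTensorModule.mk k A P W).flip w) ∘ₗ f)
    (fun f f' w => by ext; simp [TensorProduct.add_tmul])
    (fun c f w => by ext; simp [TensorProduct.smul_tmul'])
    (fun f w w' => by ext; simp)
    (fun c f w => by ext; simp))

@[simp] theorem evalHom_tmul (f : N →ₗ[A] P) (w : W) (n : N) :
    evalHom k A N P W (f ⊗ₜ w) n = f n ⊗ₜ w := rfl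

theorem evalHom_bijective [Module.Finite A N] [Module.Projective A N] :
    Function.Bijective (evalHom k A N P W) := by
  obtain ⟨d, f, g, -, -, hfg⟩ := Module.Finite.exists_comp_eq_id_of_projective A N
  let e (i : Fin d) : N := f (Pi.single i 1)
  let c (i : Fin d) : P →ₗ[k] (N →ₗ[A] P) :=
    (LinearMap.smulRightₗ (LinearMap.proj i ∘ₗ g)).restrictScalars k
  have hc (i : Fin d) (p : P) (n : N) : c i p n = g n i • p := rfl
  have he (n : N) : ∑ i, g n i • e i = n := by
    conv_rhs => rw [← LinearMap.id_apply (R := A) n, ← hfg, LinearMap.comp_apply,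
      pi_eq_sum_univ' (g n)]
    simp only [e, map_sum]
    refine Finset.sum_congr rfl fun i _ => ?_
    rw [← map_smul]
  let inv (φ : N →ₗ[A] P ⊗[k] W) : (N →ₗ[A] P) ⊗[k] W := ∑ i, (c i).rTensor W (φ (e i))
  refine Function.bijective_iff_has_inverse.2 ⟨inv, fun x => ?_, fun φ => ?_⟩
  · induction x with
    | zero => simp [inv]
    | add x y hx hy =>
      conv_rhs => rw [← hx, ← hy]
      simp [inv, Finset.sum_add_distrib]
    | tmul f w =>
      simp only [inv, evalHom_tmul, LinearMap.rTensor_tmul]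
      rw [← TensorProduct.sum_tmul]
      congr 1
      ext n
      simp only [LinearMap.sum_apply, hc]
      conv_rhs => rw [← he n]
      simp
  · ext n
    have key (i : Fin d) (x : P ⊗[k] W) :
        evalHom k A N P W ((c i).rTensor W x) n = g n i • x := by
      induction x with
      | zero => simp
      | add x y hx hy => rw [map_add, map_add, LinearMap.add_apply, hx, hy, smul_add]
      | tmul p w => simp [hc, TensorProduct.smul_tmul']
    simp only [inv, map_sum, LinearMap.sum_apply, key]
    conv_rhs => rw [← he n]
    simp

end EvalHom

section Twist

variable (k H : Type*) [CommRing k] [CommRing H] [HopfAlgebra k H]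
variable {N P : Type*} [AddCommGroup N] [Module k N] [AddCommGroup P] [Module k P]

/-- The map `(p ⊗ h) ⊗ h' ↦ p ⊗ h'h`. -/
def mulLast : (P ⊗[k] H) ⊗[k] H →ₗ[k] P ⊗[k] H :=
  (LinearMap.mul' k H ∘ₗ (TensorProduct.comm k H H).toLinearMap).lTensor P ∘ₗ
    (TensorProduct.assoc k P H H).toLinearMap

@[simp] theorem mulLast_tmul (p : P) (h h' : H) :
    mulLast k H ((p ⊗ₜ[k] h) ⊗ₜ[k] h') = p ⊗ₜ (h' * h) := by simp [mulLast]

/-- The map `N ⊗ H → P ⊗ H`, `n ⊗ h ↦ f(n)₀ ⊗ S⁻¹(h) f(n)₁`. -/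
def twistAux [RightComodule k H P] (f : N →ₗ[k] P) : N ⊗[k] H →ₗ[k] P ⊗[k] H :=
  mulLast k H ∘ₗ TensorProduct.map (coact k H ∘ₗ f) (antipodeEquiv k H).symm.toLinearMap

theorem twistAux_tmul [RightComodule k H P] (f : N →ₗ[k] P) (n : N) (h : H) :
    twistAux k H f (n ⊗ₜ h) = mulLast k H (coact k H (f n) ⊗ₜ HopfAlgebra.antipode k h) := by
  simp [twistAux]

theorem counit_mulLast (x : P ⊗[k] H) (h : H) : TensorProduct.rid k P
    ((Coalgebra.counit (R := k) (A := H)).lTensor P (mulLast k H (x ⊗ₜ h))) =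
      Coalgebra.counit (R := k) h •
        TensorProduct.rid k P ((Coalgebra.counit (R := k) (A := H)).lTensor P x) := by
  induction x with
  | zero => simp
  | add x y hx hy => simp only [TensorProduct.add_tmul, map_add, smul_add, hx, hy]
  | tmul p h' => simp [mul_smul]

theorem counit_twistAux [RightComodule k H P] (f : N →ₗ[k] P) (y : N ⊗[k] H) :
    TensorProduct.rid k P ((Coalgebra.counit (R := k) (A := H)).lTensor P (twistAux k H f y)) =
      f (TensorProduct.rid k N ((Coalgebra.counit (R := k) (A := H)).lTensor N y)) := by
  induction y with
  | zero => simp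
  | add x y hx hy => simp only [map_add, hx, hy]
  | tmul n h =>
    rw [twistAux_tmul, counit_mulLast, RightComodule.counit]
    simp

/-- The map `(p ⊗ h) ⊗ s ↦ p₀ ⊗ S(s)p₁ ⊗ h`. -/
def twistG [RightComodule k H P] : (P ⊗[k] H) ⊗[k] H →ₗ[k] P ⊗[k] (H ⊗[k] H) :=
  (TensorProduct.assoc k P H H).toLinearMap ∘ₗ
    (twistAux k H (LinearMap.id : P →ₗ[k] P)).rTensor H ∘ₗ
      (TensorProduct.rightComm k P H H).toLinearMap

theorem twistG_tmul [RightComodule k H P] (p : P) (h s : H) :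
    twistG k H ((p ⊗ₜ[k] h) ⊗ₜ[k] s) = TensorProduct.assoc k P H H
      (mulLast k H (coact k H p ⊗ₜ HopfAlgebra.antipode k s) ⊗ₜ h) := by
  simp [twistG, twistAux_tmul]

theorem comul_mulLast (x : P ⊗[k] H) (h : H) :
    (Coalgebra.comul (R := k) (A := H)).lTensor P (mulLast k H (x ⊗ₜ h)) =
      (LinearMap.mul k (H ⊗[k] H) (Coalgebra.comul (R := k) h)).lTensor P
        ((Coalgebra.comul (R := k) (A := H)).lTensor P x) := by
  induction x with
  | zero => simp
  | add x y hx hy => simp only [TensorProduct.add_tmul, map_add, hx, hy]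
  | tmul p h' => simp

theorem twistG_mulLast [RightComodule k H P] (x : P ⊗[k] H) (c₁ c₂ : H) :
    twistG k H (mulLast k H (x ⊗ₜ HopfAlgebra.antipode k c₁) ⊗ₜ c₂) =
      (LinearMap.mul k (H ⊗[k] H) (HopfAlgebra.antipode k c₂ ⊗ₜ[k] HopfAlgebra.antipode k c₁)).lTensor P
        (TensorProduct.assoc k P H H ((coact k H).rTensor H x)) := by
  induction x with
  | zero => simp
  | add x y hx hy => simp only [TensorProduct.add_tmul, map_add, hx, hy]
  | tmul p h =>
    rw [mulLast_tmul, twistG_tmul, LinearMap.rTensor_tmul]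
    induction coact k H p with
    | zero => simp
    | add x y hx hy => simp only [TensorProduct.add_tmul, map_add, hx, hy]
    | tmul p h' => simp

theorem twistG_twistAux [RightComodule k H P] (f : N →ₗ[k] P) (y : N ⊗[k] H) :
    twistG k H ((twistAux k H f).rTensor H ((TensorProduct.assoc k N H H).symm
      ((Coalgebra.comul (R := k) (A := H)).lTensor N y))) =
      (Coalgebra.comul (R := k) (A := H)).lTensor P (twistAux k H f y) := by
  induction y with
  | zero => simp
  | add x y hx hy => simp only [map_add, hx, hy]
  | tmul n h =>
    rw [twistAux_tmul, comul_mulLast, ← RightComodule.coassoc, comul_antipode',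
      LinearMap.lTensor_tmul]
    induction Coalgebra.comul (R := k) h with
    | zero => simp
    | add x y hx hy =>
      simp only [TensorProduct.tmul_add, map_add, hx, hy, 
        LinearMap.lTensor_add, LinearMap.add_apply]
    | tmul c₁ c₂ =>
      rw [TensorProduct.assoc_symm_tmul, LinearMap.rTensor_tmul, twistAux_tmul, twistG_mulLast]
      simp

end Twist

section Ihom

variable (k H A : Type*) [CommRing k] [CommRing H] [HopfAlgebra k H] [CommRing A] [Algebra k A]
variable (N P : Type*) [AddCommGroup N] [Module k N] [Module A N] [IsScalarTower k A N]
  [AddCommGroup P] [Module k P] [Module A P] [IsScalarTower k A P]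

theorem mulLast_diagAct (y : P ⊗[k] H) (a : A) (c h s : H) :
    mulLast k H (diagAct k H A P (a ⊗ₜ c) y ⊗ₜ (h * s)) =
      diagAct k H A P (a ⊗ₜ (c * h)) (mulLast k H (y ⊗ₜ s)) := by
  induction y with
  | zero => simp
  | add x y hx hy => simp only [TensorProduct.add_tmul, map_add, hx, hy]
  | tmul p h' =>
    simp only [diagAct_tmul, mulLast_tmul]
    congr 1
    ring

/-- The map `a ⊗ c ⊗ d ↦ a ⊗ c S(d)`. -/
def mulAntipode : A ⊗[k] (H ⊗[k] H) →ₗ[k] A ⊗[k] H :=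
  (LinearMap.mul' k H ∘ₗ (HopfAlgebra.antipode k).lTensor H).lTensor A

theorem mulAntipode_comul (x : A ⊗[k] H) :
    mulAntipode k H A ((Coalgebra.comul (R := k) (A := H)).lTensor A x) =
      TensorProduct.rid k A ((Coalgebra.counit (R := k) (A := H)).lTensor A x) ⊗ₜ 1 := by
  induction x with
  | zero => simp
  | add x y hx hy => simp only [map_add, hx, hy, TensorProduct.add_tmul]
  | tmul a h =>
    simp only [mulAntipode, LinearMap.lTensor_tmul, LinearMap.comp_apply,
      HopfAlgebra.mul_antipode_lTensor_comul_apply, TensorProduct.rid_tmul,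
      Algebra.algebraMap_eq_smul_one, TensorProduct.tmul_smul, TensorProduct.smul_tmul']

variable [ComoduleAlgebra k H A] [RightComodule k H N] [RightComodule k H P]
  [IsRelHopf k H A N] [IsRelHopf k H A P]
variable {N P}

theorem twistAux_diagAct (f : N →ₗ[A] P) (x : A ⊗[k] H) (y : N ⊗[k] H) :
    twistAux k H (f.restrictScalars k) (diagAct k H A N x y) =
      diagAct k H A P (mulAntipode k H A (TensorProduct.assoc k A H H
        ((coact k H : A →ₗ[k] _).rTensor H x))) (twistAux k H (f.restrictScalars k) y) := by
  induction x with
  | zero => simp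
  | add x x' hx hx' => simp only [map_add, LinearMap.add_apply, hx, hx']
  | tmul a h =>
    induction y with
    | zero => simp
    | add y y' hy hy' => simp only [map_add, hy, hy']
    | tmul n s =>
      rw [diagAct_tmul, twistAux_tmul, twistAux_tmul, LinearMap.rTensor_tmul,
        LinearMap.restrictScalars_apply, map_smul, IsRelHopf.coact_smul,
        HopfAlgebra.antipode_mul_distrib]
      induction (coact k H a : A ⊗[k] H) with
      | zero => simp
      | add x x' hx hx' =>
        simp only [map_add, LinearMap.add_apply, TensorProduct.add_tmul, hx, hx']
      | tmul b c =>
        rw [mulLast_diagAct]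
        simp [mulAntipode]

/-- For `f ∈ Hom_A(N, P)`, the `A`-linear map `N → P ⊗ H`, `n ↦ f(n₀)₀ ⊗ S⁻¹(n₁) f(n₀)₁`. -/
def twist (f : N →ₗ[A] P) : N →ₗ[A] P ⊗[k] H where
  toFun n := twistAux k H (f.restrictScalars k) (coact k H n)
  map_add' n n' := by simp
  map_smul' a n := by
    have e (y : P ⊗[k] H) : diagAct k H A P (a ⊗ₜ 1) y = a • y := by
      induction y with
      | zero => simp
      | add x y hx hy => rw [map_add, hx, hy, smul_add]
      | tmul p h => simp [TensorProduct.smul_tmul']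
    rw [IsRelHopf.coact_smul, twistAux_diagAct, RightComodule.coassoc, mulAntipode_comul,
      RightComodule.counit, e]
    rfl

theorem twist_apply (f : N →ₗ[A] P) (n : N) :
    twist k H A f n = twistAux k H (f.restrictScalars k) (coact k H n) := rfl

variable (N P) in
/-- `twist` as a `k`-linear map. -/
def twistₗ : (N →ₗ[A] P) →ₗ[k] (N →ₗ[A] P ⊗[k] H) where
  toFun := twist k H A
  map_add' f g := by
    ext n
    simp only [twist_apply, LinearMap.add_apply]
    induction (coact k H n : N ⊗[k] H) with
    | zero => simp
    | add x y hx hy =>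
      simp only [map_add, hx, hy]
      abel
    | tmul n h => simp [twistAux_tmul, TensorProduct.add_tmul]
  map_smul' c f := by
    ext n
    simp only [twist_apply, LinearMap.smul_apply, RingHom.id_apply]
    induction (coact k H n : N ⊗[k] H) with
    | zero => simp
    | add x y hx hy => simp only [map_add, hx, hy, smul_add]
    | tmul n h =>
      rw [twistAux_tmul, twistAux_tmul, ← map_smul, TensorProduct.smul_tmul']
      simp

variable (N P)
variable [Module.Finite A N] [Module.Projective A N]

/-- The coaction `π` on `Hom_A(N, P)`, for `N` finitely generated projective over `A`:
identifying `Hom_A(N, P) ⊗ H` with `Hom_A(N, P ⊗ H)`, it is determined by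
`π(f)(n) = f₀(n) ⊗ f₁ = f(n₀)₀ ⊗ S⁻¹(n₁) f(n₀)₁`. -/
def ihomCoact : (N →ₗ[A] P) →ₗ[k] (N →ₗ[A] P) ⊗[k] H :=
  (LinearEquiv.ofBijective (evalHom k A N P H) (evalHom_bijective k A N P H)).symm.toLinearMap ∘ₗ
    twistₗ k H A N P

theorem evalHom_ihomCoact (f : N →ₗ[A] P) :
    evalHom k A N P H (ihomCoact k H A N P f) = twist k H A f :=
  (LinearEquiv.ofBijective (evalHom k A N P H) (evalHom_bijective k A N P H)).apply_symm_apply _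

theorem evalHom_assoc_ihomCoact (z : (N →ₗ[A] P) ⊗[k] H) (n : N) :
    evalHom k A N P (H ⊗[k] H) (TensorProduct.assoc k _ H H ((ihomCoact k H A N P).rTensor H z)) n =
      twistG k H (((evalHom k A N P H z).restrictScalars k).rTensor H (coact k H n)) := by
  induction z with
  | zero => simp
  | add x y hx hy =>
    simp only [map_add, LinearMap.add_apply, hx, hy, LinearMap.restrictScalars_add,
      LinearMap.rTensor_add]
  | tmul g h =>
    have e1 (w : (N →ₗ[A] P) ⊗[k] H) : evalHom k A N P (H ⊗[k] H)
        (TensorProduct.assoc k _ H H (w ⊗ₜ h)) n =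
          TensorProduct.assoc k P H H (evalHom k A N P H w n ⊗ₜ h) := by
      induction w with
      | zero => simp
      | add x y hx hy =>
        simp only [TensorProduct.add_tmul, map_add, LinearMap.add_apply, hx, hy]
      | tmul g h' => simp
    rw [LinearMap.rTensor_tmul, e1, evalHom_ihomCoact, twist_apply]
    induction (coact k H n : N ⊗[k] H) with
    | zero => simp
    | add x y hx hy => simp only [map_add, TensorProduct.add_tmul, hx, hy]
    | tmul n s => simp [twistAux_tmul, twistG_tmul]

/-- The `H`-comodule `Hom_A(N, P)`. -/
abbrev RightComodule.ihom : RightComodule k H (N →ₗ[A] P) where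
  coact := ihomCoact k H A N P
  coassoc f := by
    apply (evalHom_bijective k A N P (H ⊗[k] H)).injective
    ext n
    have e1 (z : (N →ₗ[A] P) ⊗[k] H) : evalHom k A N P (H ⊗[k] H)
        ((Coalgebra.comul (R := k) (A := H)).lTensor _ z) n =
          (Coalgebra.comul (R := k) (A := H)).lTensor P (evalHom k A N P H z n) := by
      induction z with
      | zero => simp
      | add x y hx hy => simp only [map_add, LinearMap.add_apply, hx, hy]
      | tmul g h' => simp
    rw [evalHom_assoc_ihomCoact, e1, evalHom_ihomCoact, twist_apply, ← twistG_twistAux,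
      ← RightComodule.coassoc, LinearEquiv.symm_apply_apply,
      ← LinearMap.comp_apply (LinearMap.rTensor H (twistAux _ _ _)), ← LinearMap.rTensor_comp]
    rfl
  counit f := by
    ext n
    have e1 (z : (N →ₗ[A] P) ⊗[k] H) : TensorProduct.rid k _
        ((Coalgebra.counit (R := k) (A := H)).lTensor _ z) n =
          TensorProduct.rid k P
            ((Coalgebra.counit (R := k) (A := H)).lTensor P (evalHom k A N P H z n)) := by
      induction z with
      | zero => simp
      | add x y hx hy => simp only [map_add, LinearMap.add_apply, hx, hy]
      | tmul g h' => simp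
    rw [e1, evalHom_ihomCoact, twist_apply, counit_twistAux, RightComodule.counit]
    rfl

theorem isRelHopf_ihom :
    let _ := RightComodule.ihom k H A N P
    IsRelHopf k H A (N →ₗ[A] P) := by
  let _ := RightComodule.ihom k H A N P
  refine ⟨fun a f => ?_⟩
  change ihomCoact k H A N P (a • f) = diagAct k H A _ (coact k H a) (ihomCoact k H A N P f)
  apply (evalHom_bijective k A N P H).injective
  ext n
  have e1 (x : A ⊗[k] H) (z : (N →ₗ[A] P) ⊗[k] H) :
      evalHom k A N P H (diagAct k H A (N →ₗ[A] P) x z) n =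
        diagAct k H A P x (evalHom k A N P H z n) := by
    induction x with
    | zero => simp
    | add x x' hx hx' => simp only [map_add, LinearMap.add_apply, hx, hx']
    | tmul b h =>
      induction z with
      | zero => simp
      | add y y' hy hy' => simp only [map_add, LinearMap.add_apply, hy, hy']
      | tmul g h' => simp
  rw [evalHom_ihomCoact, e1, evalHom_ihomCoact, twist_apply, twist_apply]
  induction (coact k H n : N ⊗[k] H) with
  | zero => simp
  | add x y hx hy => simp only [map_add, hx, hy]
  | tmul n s =>
    rw [twistAux_tmul, twistAux_tmul]
    simp only [LinearMap.restrictScalars_apply, LinearMap.smul_apply, IsRelHopf.coact_smul]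
    induction (coact k H a : A ⊗[k] H) with
    | zero => simp
    | add x x' hx hx' =>
      simp only [map_add, LinearMap.add_apply, TensorProduct.add_tmul, hx, hx']
    | tmul b c => simpa using mulLast_diagAct k H A P (coact k H (f n)) b c 1 (HopfAlgebra.antipode k s)

end Ihom

section

variable {k H A : Type*} [CommRing k] [CommRing H] [Bialgebra k H] [CommRing A] [Algebra k A]

theorem rTensor_diagAct {X Y : Type*} [AddCommGroup X] [Module k X] [Module A X]
    [IsScalarTower k A X] [AddCommGroup Y] [Module k Y] [Module A Y] [IsScalarTower k A Y]
    (f : X →ₗ[A] Y) (x : A ⊗[k] H) (y : X ⊗[k] H) :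
    (f.restrictScalars k).rTensor H (diagAct k H A X x y) =
      diagAct k H A Y x ((f.restrictScalars k).rTensor H y) := by
  induction x with
  | zero => simp
  | add x x' hx hx' => simp only [map_add, LinearMap.add_apply, hx, hx']
  | tmul a h =>
    induction y with
    | zero => simp
    | add y y' hy hy' => simp only [map_add, hy, hy']
    | tmul m h' => simp

theorem isRelHopf_of_surjective [ComoduleAlgebra k H A] {X Y : Type*} [AddCommGroup X] [Module k X]
    [Module A X] [IsScalarTower k A X] [AddCommGroup Y] [Module k Y] [Module A Y]
    [IsScalarTower k A Y] [RightComodule k H X] [RightComodule k H Y] [IsRelHopf k H A X]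
    (p : X →ₗ[A] Y) (hp : Function.Surjective p)
    (h : ∀ x, coact k H (p x) = (p.restrictScalars k).rTensor H (coact k H x)) :
    IsRelHopf k H A Y where
  coact_smul a y := by
    obtain ⟨x, rfl⟩ := hp y
    rw [← map_smul, h, h, IsRelHopf.coact_smul, rTensor_diagAct]

theorem isRelHopf_of_injective [ComoduleAlgebra k H A] {X Y : Type*} [AddCommGroup X] [Module k X]
    [Module A X] [IsScalarTower k A X] [AddCommGroup Y] [Module k Y] [Module A Y]
    [IsScalarTower k A Y] [RightComodule k H X] [RightComodule k H Y] [IsRelHopf k H A Y]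
    (i : X →ₗ[A] Y) (hi : Function.Injective ((i.restrictScalars k).rTensor H))
    (h : ∀ x, coact k H (i x) = (i.restrictScalars k).rTensor H (coact k H x)) :
    IsRelHopf k H A X where
  coact_smul a x := by
    apply hi
    rw [← h, map_smul, rTensor_diagAct, ← h, IsRelHopf.coact_smul]

end

/-- A relative `(A, H)`-Hopf module: a `k`-module with an `A`-action and an `H`-coaction such that
`ρ(am) = a₀m₀ ⊗ a₁m₁`. -/
structure RelHopfModule (k H A : Type u) [CommRing k] [CommRing H] [Bialgebra k H]
    [CommRing A] [Algebra k A] [ComoduleAlgebra k H A] : Type (u + 1) where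
  /-- the underlying type -/
  carrier : Type u
  [addCommGroup : AddCommGroup carrier]
  [moduleBase : Module k carrier]
  [moduleAlg : Module A carrier]
  [isScalarTower : IsScalarTower k A carrier]
  [comodule : RightComodule k H carrier]
  [isRelHopf : IsRelHopf k H A carrier]

namespace RelHopfModule

attribute [instance] addCommGroup moduleBase moduleAlg isScalarTower comodule isRelHopf

section CommRing

variable {k H A : Type u} [CommRing k] [CommRing H] [Bialgebra k H]
    [CommRing A] [Algebra k A] [ComoduleAlgebra k H A]

instance : CoeSort (RelHopfModule k H A) (Type u) := ⟨carrier⟩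

/-- The `k`-module of `A`-linear maps `f : M → N` that are `H`-colinear,
i.e. `ρ(f(m)) = f(m₀) ⊗ m₁`. -/
def homs (M N : RelHopfModule k H A) : Submodule k (M →ₗ[A] N) where
  carrier := {f | ∀ m : M, coact k H (f m) = (f.restrictScalars k).rTensor H (coact k H m)}
  zero_mem' m := by simp
  add_mem' {f g} hf hg m := by
    rw [LinearMap.restrictScalars_add, LinearMap.rTensor_add, LinearMap.add_apply,
      LinearMap.add_apply, map_add, hf, hg]
  smul_mem' c f hf m := by
    have : (c • f).restrictScalars k = c • f.restrictScalars k := rfl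
    rw [this, LinearMap.rTensor_smul, LinearMap.smul_apply, LinearMap.smul_apply, map_smul, hf]

/-- The category of relative `(A, H)`-Hopf modules with `A`-linear `H`-colinear maps. -/
instance : Category (RelHopfModule k H A) where
  Hom M N := homs M N
  id M := ⟨LinearMap.id, fun m => by
    have : (LinearMap.id : M →ₗ[A] M).restrictScalars k = LinearMap.id := rfl
    simp [this]⟩
  comp {M N P} f g := ⟨g.1 ∘ₗ f.1, fun m => by
    have : (g.1 ∘ₗ f.1).restrictScalars k = g.1.restrictScalars k ∘ₗ f.1.restrictScalars k := rfl
    rw [this, LinearMap.rTensor_comp, LinearMap.comp_apply, LinearMap.comp_apply, g.2, f.2]⟩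

/-- The `A`-linear map underlying a morphism. -/
def Hom.lin {M N : RelHopfModule k H A} (f : M ⟶ N) : M →ₗ[A] N := Subtype.val f

/-- A colinear map as a morphism. -/
def ofLin {M N : RelHopfModule k H A} (f : M →ₗ[A] N)
    (hf : ∀ m : M, coact k H (f m) = (f.restrictScalars k).rTensor H (coact k H m)) : M ⟶ N :=
  ⟨f, hf⟩

variable {M N P : RelHopfModule k H A}

theorem Hom.colinear (f : M ⟶ N) (m : M) : coact k H (Hom.lin f m) =
    ((Hom.lin f).restrictScalars k).rTensor H (coact k H m) := f.2 m

@[simp] theorem lin_ofLin (f : M →ₗ[A] N)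
    (hf : ∀ m : M, coact k H (f m) = (f.restrictScalars k).rTensor H (coact k H m)) :
    Hom.lin (ofLin f hf) = f := rfl

@[simp] theorem lin_id : Hom.lin (𝟙 M) = LinearMap.id := rfl
@[simp] theorem lin_comp (f : M ⟶ N) (g : N ⟶ P) :
    Hom.lin (f ≫ g) = Hom.lin g ∘ₗ Hom.lin f := rfl

theorem hom_ext' {f g : M ⟶ N} (h : ∀ m, Hom.lin f m = Hom.lin g m) : f = g :=
  Subtype.ext (LinearMap.ext h)

instance : Preadditive (RelHopfModule k H A) where
  homGroup M N := inferInstanceAs (AddCommGroup (homs M N))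
  add_comp _ _ _ f f' g := hom_ext' fun m => map_add (Hom.lin g) (Hom.lin f m) (Hom.lin f' m)
  comp_add _ _ _ _ _ _ := rfl

instance : Linear k (RelHopfModule k H A) where
  homModule M N := inferInstanceAs (Module k (homs M N))
  smul_comp _ _ _ c f g := hom_ext' fun m =>
    map_smul ((Hom.lin g).restrictScalars k) c (Hom.lin f m)
  comp_smul _ _ _ _ _ _ := rfl

@[simp] theorem lin_zero : Hom.lin (0 : M ⟶ N) = 0 := rfl
@[simp] theorem lin_add (f g : M ⟶ N) : Hom.lin (f + g) = Hom.lin f + Hom.lin g := rfl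

/-- The zero object. -/
instance : HasZeroObject (RelHopfModule k H A) := by
  let _ : RightComodule k H PUnit.{u + 1} :=
    { coact := 0, coassoc := fun _ => by simp, counit := fun _ => by simp }
  have : IsRelHopf k H A PUnit.{u + 1} := ⟨fun _ _ => by
    change (0 : PUnit.{u + 1} →ₗ[k] _) _ = diagAct k H A _ _ ((0 : PUnit.{u + 1} →ₗ[k] _) _)
    simp⟩
  refine ⟨⟨⟨PUnit.{u + 1}⟩, fun Y => ⟨⟨⟨0⟩, fun f => ?_⟩⟩, fun Y => ⟨⟨⟨0⟩, fun f => ?_⟩⟩⟩⟩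
  · refine hom_ext' fun m => ?_
    have : m = 0 := rfl
    rw [this, map_zero, map_zero]
  · exact hom_ext' fun m => rfl

/-- The direct sum of two relative Hopf modules. -/
def prod (M N : RelHopfModule k H A) : RelHopfModule k H A :=
  letI := RightComodule.prod k H M N
  { carrier := M × N
    isRelHopf := ⟨fun a x => by
      have h1 := rTensor_diagAct (k := k) (H := H) (LinearMap.inl A M N) (coact k H a)
        (coact k H x.1)
      have h2 := rTensor_diagAct (k := k) (H := H) (LinearMap.inr A M N) (coact k H a)
        (coact k H x.2)
      rw [← IsRelHopf.coact_smul] at h1 h2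
      refine (congrArg₂ (· + ·) h1 h2).trans ?_
      rw [← map_add]
      rfl⟩ }

/-- A structure map of the direct sum. -/
def prodInl (M N : RelHopfModule k H A) : M →ₗ[A] prod M N := LinearMap.inl A M N

/-- A structure map of the direct sum. -/
def prodInr (M N : RelHopfModule k H A) : N →ₗ[A] prod M N := LinearMap.inr A M N

/-- A structure map of the direct sum. -/
def prodFst (M N : RelHopfModule k H A) : prod M N →ₗ[A] M := LinearMap.fst A M N

/-- A structure map of the direct sum. -/
def prodSnd (M N : RelHopfModule k H A) : prod M N →ₗ[A] N := LinearMap.snd A M N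

theorem prod_inl (m : M) : coact k H (prodInl M N m) =
    ((prodInl M N).restrictScalars k).rTensor H (coact k H m) :=
  congr($(prodCoact_inl k H M N) m)

theorem prod_inr (m : N) : coact k H (prodInr M N m) =
    ((prodInr M N).restrictScalars k).rTensor H (coact k H m) :=
  congr($(prodCoact_inr k H M N) m)

theorem prod_fst (x : prod M N) : coact k H (prodFst M N x) =
    ((prodFst M N).restrictScalars k).rTensor H (coact k H x) :=
  congr($(prodCoact_fst k H M N) x).symm

theorem prod_snd (x : prod M N) : coact k H (prodSnd M N x) =
    ((prodSnd M N).restrictScalars k).rTensor H (coact k H x) :=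
  congr($(prodCoact_snd k H M N) x).symm

instance : HasBinaryBiproducts (RelHopfModule k H A) where
  has_binary_biproduct M N := hasBinaryBiproduct_of_total
    { pt := prod M N
      fst := ofLin (prodFst M N) prod_fst
      snd := ofLin (prodSnd M N) prod_snd
      inl := ofLin (prodInl M N) prod_inl
      inr := ofLin (prodInr M N) prod_inr
      inl_fst := rfl
      inl_snd := rfl
      inr_fst := rfl
      inr_snd := rfl }
    (hom_ext' fun m => Prod.ext (add_zero m.1) (zero_add m.2))

instance : HasFiniteProducts (RelHopfModule k H A) :=
  hasFiniteProducts_of_has_binary_and_terminal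

end CommRing

section Field

variable {k H A : Type u} [Field k] [CommRing H] [Bialgebra k H]
    [CommRing A] [Algebra k A] [ComoduleAlgebra k H A]

theorem rTensor_injective {X Y : Type*} [AddCommGroup X] [Module k X] [AddCommGroup Y]
    [Module k Y] (f : X →ₗ[k] Y) (hf : Function.Injective f) :
    Function.Injective (f.rTensor H) :=
  Module.Flat.rTensor_preserves_injective_linearMap f hf

section Lift

variable {K M N : RelHopfModule k H A}

/-- Lifting a morphism along an injective morphism. -/
theorem exists_lift (i : K ⟶ M) (hi : Function.Injective (Hom.lin i)) (g : N ⟶ M)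
    (h : ∀ n, Hom.lin g n ∈ LinearMap.range (Hom.lin i)) : ∃ l : N ⟶ K, l ≫ i = g := by
  let e := LinearEquiv.ofInjective (Hom.lin i) hi
  let l : N →ₗ[A] K := e.symm.toLinearMap ∘ₗ (Hom.lin g).codRestrict _ h
  have hl : Hom.lin i ∘ₗ l = Hom.lin g := by
    ext n
    exact congrArg Subtype.val (e.apply_symm_apply ((Hom.lin g).codRestrict _ h n))
  have hlk : (Hom.lin i).restrictScalars k ∘ₗ l.restrictScalars k = (Hom.lin g).restrictScalars k :=
    LinearMap.ext fun n => congr($hl n)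
  refine ⟨ofLin l fun n => ?_, hom_ext' fun n => congr($hl n)⟩
  apply rTensor_injective (H := H) ((Hom.lin i).restrictScalars k) hi
  rw [← Hom.colinear, ← LinearMap.comp_apply (LinearMap.rTensor H _), ← LinearMap.rTensor_comp, hlk,
    ← Hom.colinear]
  congr 1
  exact congr($hl n)

/-- Factoring a morphism through a surjective morphism. -/
theorem exists_desc (p : M ⟶ K) (hp : Function.Surjective (Hom.lin p)) (g : M ⟶ N)
    (h : ∀ m, Hom.lin p m = 0 → Hom.lin g m = 0) : ∃ l : K ⟶ N, p ≫ l = g := by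
  let e := (Hom.lin p).quotKerEquivOfSurjective hp
  let l : K →ₗ[A] N := ((LinearMap.ker (Hom.lin p)).liftQ (Hom.lin g) h) ∘ₗ e.symm.toLinearMap
  have hl (m : M) : l (Hom.lin p m) = Hom.lin g m := by
    have : e.symm (Hom.lin p m) = (LinearMap.ker (Hom.lin p)).mkQ m := by
      rw [LinearEquiv.symm_apply_eq]
      rfl
    simp only [l, LinearMap.comp_apply, LinearEquiv.coe_coe, this]
    exact Submodule.liftQ_apply _ _ _
  have hlk : l.restrictScalars k ∘ₗ (Hom.lin p).restrictScalars k = (Hom.lin g).restrictScalars k :=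
    LinearMap.ext hl
  refine ⟨ofLin l fun x => ?_, hom_ext' hl⟩
  obtain ⟨m, rfl⟩ := hp x
  rw [hl, Hom.colinear, Hom.colinear, ← hlk, LinearMap.rTensor_comp, LinearMap.comp_apply]

end Lift

variable {M N : RelHopfModule k H A}

theorem coact_ker (f : M ⟶ N) (x : LinearMap.ker (Hom.lin f)) :
    coact k H ((LinearMap.ker (Hom.lin f)).subtype.restrictScalars k x) ∈
      LinearMap.range (((LinearMap.ker (Hom.lin f)).subtype.restrictScalars k).rTensor H) := by
  have ex : Function.Exact ((LinearMap.ker (Hom.lin f)).subtype.restrictScalars k)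
      ((Hom.lin f).restrictScalars k) := fun y => by
    simp
  refine (Module.Flat.rTensor_exact H ex _).1 ?_
  rw [← Hom.colinear]
  simp

/-- The kernel of a morphism, with the restricted coaction. -/
def kernelObj (f : M ⟶ N) : RelHopfModule k H A :=
  letI := RightComodule.sub ((LinearMap.ker (Hom.lin f)).subtype.restrictScalars k)
    Subtype.val_injective (coact_ker f)
  { carrier := LinearMap.ker (Hom.lin f)
    isRelHopf := isRelHopf_of_injective (LinearMap.ker (Hom.lin f)).subtype
      (rTensor_injective _ Subtype.val_injective) fun x =>
        (RightComodule.sub_coact ((LinearMap.ker (Hom.lin f)).subtype.restrictScalars k)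
          Subtype.val_injective (coact_ker f) x).symm }

/-- The inclusion of the kernel. -/
def kernelι (f : M ⟶ N) : kernelObj f ⟶ M :=
  ofLin (LinearMap.ker (Hom.lin f)).subtype fun x =>
    (RightComodule.sub_coact ((LinearMap.ker (Hom.lin f)).subtype.restrictScalars k)
        Subtype.val_injective (coact_ker f) x).symm

theorem kernelι_injective (f : M ⟶ N) : Function.Injective (Hom.lin (kernelι f)) :=
  Subtype.val_injective

theorem kernelι_comp (f : M ⟶ N) : kernelι f ≫ f = 0 := hom_ext' fun x => x.2

theorem mono_of_injective (f : M ⟶ N) (hf : Function.Injective (Hom.lin f)) : Mono f where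
  right_cancellation _ _ e := hom_ext' fun x => hf congr(Hom.lin $e x)

theorem epi_of_surjective (f : M ⟶ N) (hf : Function.Surjective (Hom.lin f)) : Epi f where
  left_cancellation _ _ e := hom_ext' fun x => by
    obtain ⟨y, rfl⟩ := hf x
    exact congr(Hom.lin $e y)

theorem injective_of_mono (f : M ⟶ N) [Mono f] : Function.Injective (Hom.lin f) := by
  rw [injective_iff_map_eq_zero]
  intro x hx
  have h : kernelι f = 0 := by rw [← cancel_mono f, kernelι_comp, zero_comp]
  exact congr(Hom.lin $h ⟨x, hx⟩)

/-- An injective morphism is a kernel of every morphism with which it forms an exact sequence. -/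
def isLimitOfExact {K : RelHopfModule k H A} (i : K ⟶ M) (f : M ⟶ N) (w : i ≫ f = 0)
    (hi : Function.Injective (Hom.lin i))
    (h : ∀ x, Hom.lin f x = 0 → x ∈ LinearMap.range (Hom.lin i)) :
    IsLimit (KernelFork.ofι i w) :=
  haveI := mono_of_injective i hi
  KernelFork.IsLimit.ofι' i w fun g hg =>
    have e := exists_lift i hi g fun n => h _ congr(Hom.lin $hg n)
    ⟨e.choose, e.choose_spec⟩

/-- A surjective morphism is a cokernel of every morphism with which it forms an exact sequence. -/
def isColimitOfExact {K : RelHopfModule k H A} (f : M ⟶ N) (p : N ⟶ K) (w : f ≫ p = 0)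
    (hp : Function.Surjective (Hom.lin p))
    (h : ∀ x, Hom.lin p x = 0 → x ∈ LinearMap.range (Hom.lin f)) :
    IsColimit (CokernelCofork.ofπ p w) :=
  haveI := epi_of_surjective p hp
  CokernelCofork.IsColimit.ofπ' p w fun g hg =>
    have e := exists_desc p hp g fun n hn => by
      obtain ⟨m, rfl⟩ := h n hn
      exact congr(Hom.lin $hg m)
    ⟨e.choose, e.choose_spec⟩

/-- The projection onto the cokernel of the underlying map. -/
def cokernelProj (f : M ⟶ N) : N →ₗ[A] N ⧸ LinearMap.range (Hom.lin f) :=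
  (LinearMap.range (Hom.lin f)).mkQ

theorem cokernelProj_surjective (f : M ⟶ N) :
    Function.Surjective ((cokernelProj f).restrictScalars k) :=
  (LinearMap.range (Hom.lin f)).mkQ_surjective

theorem cokernelProj_eq_zero (f : M ⟶ N) (x : N) :
    cokernelProj f x = 0 ↔ x ∈ LinearMap.range (Hom.lin f) :=
  Submodule.Quotient.mk_eq_zero _

theorem coact_range (f : M ⟶ N) (x : N) (hx : (cokernelProj f).restrictScalars k x = 0) :
    ((cokernelProj f).restrictScalars k).rTensor H (coact k H x) = 0 := by
  obtain ⟨m, rfl⟩ := (cokernelProj_eq_zero f x).1 hx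
  have h0 : (cokernelProj f).restrictScalars k ∘ₗ (Hom.lin f).restrictScalars k =
      0 := LinearMap.ext fun m => (cokernelProj_eq_zero f _).2 ⟨m, rfl⟩
  rw [Hom.colinear, ← LinearMap.comp_apply (LinearMap.rTensor H _), ← LinearMap.rTensor_comp, h0]
  simp

/-- The cokernel of a morphism, with the induced coaction. -/
def cokernelObj (f : M ⟶ N) : RelHopfModule k H A :=
  letI := RightComodule.quot ((cokernelProj f).restrictScalars k)
    (cokernelProj_surjective f) (coact_range f)
  { carrier := N ⧸ LinearMap.range (Hom.lin f)
    isRelHopf := isRelHopf_of_surjective (cokernelProj f) (cokernelProj_surjective f)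
      (RightComodule.quot_coact ((cokernelProj f).restrictScalars k)
        (cokernelProj_surjective f) (coact_range f)) }

/-- The projection to the cokernel. -/
def cokernelπ (f : M ⟶ N) : N ⟶ cokernelObj f :=
  ofLin (cokernelProj f) (RightComodule.quot_coact ((cokernelProj f).restrictScalars k)
    (cokernelProj_surjective f) (coact_range f))

theorem cokernelπ_surjective (f : M ⟶ N) : Function.Surjective (Hom.lin (cokernelπ f)) :=
  cokernelProj_surjective f

theorem cokernelπ_eq_zero (f : M ⟶ N) (x : N) :
    Hom.lin (cokernelπ f) x = 0 ↔ x ∈ LinearMap.range (Hom.lin f) :=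
  cokernelProj_eq_zero f x

theorem comp_cokernelπ (f : M ⟶ N) : f ≫ cokernelπ f = 0 :=
  hom_ext' fun x => (cokernelπ_eq_zero f _).2 ⟨x, rfl⟩

theorem surjective_of_epi (f : M ⟶ N) [Epi f] : Function.Surjective (Hom.lin f) := fun x => by
  have h : cokernelπ f = 0 := by rw [← cancel_epi f, comp_cokernelπ, comp_zero]
  exact (cokernelπ_eq_zero f x).1 congr(Hom.lin $h x)

/-- Over a field, relative Hopf modules form an abelian category, with kernels and cokernels
computed on underlying modules. -/
instance : Abelian (RelHopfModule k H A) where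
  has_kernels := ⟨fun f => ⟨⟨_, isLimitOfExact (kernelι f) f (kernelι_comp f)
    (kernelι_injective f) fun x hx => ⟨⟨x, hx⟩, rfl⟩⟩⟩⟩
  has_cokernels := ⟨fun f => ⟨⟨_, isColimitOfExact f (cokernelπ f) (comp_cokernelπ f)
    (cokernelπ_surjective f) fun x hx => (cokernelπ_eq_zero f x).1 hx⟩⟩⟩
  normalMonoOfMono f _ := ⟨⟨_, cokernelπ f, comp_cokernelπ f,
    isLimitOfExact f (cokernelπ f) (comp_cokernelπ f) (injective_of_mono f)
      fun x hx => (cokernelπ_eq_zero f x).1 hx⟩⟩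
  normalEpiOfEpi f _ := ⟨⟨_, kernelι f, kernelι_comp f,
    isColimitOfExact (kernelι f) f (kernelι_comp f) (surjective_of_epi f)
      fun x hx => ⟨⟨x, hx⟩, rfl⟩⟩⟩

section Cofree

variable (V : Type u) [AddCommGroup V] [Module k V] [Module A V] [IsScalarTower k A V]

variable (k H A) in
/-- The cofree relative Hopf module on an `A`-module. -/
def cofree : RelHopfModule k H A :=
  { carrier := Cofree k H V }

variable (k H A) in
/-- The `A`-linear map `V ⊗ H → V`, `v ⊗ h ↦ ε(h)v`. -/
def cofreeCounit : cofree k H A V →ₗ[A] V where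
  toFun := fun (x : V ⊗[k] H) =>
    TensorProduct.rid k V ((Coalgebra.counit (R := k) (A := H)).lTensor V x)
  map_add' := fun (x y : V ⊗[k] H) => by
    exact map_add ((TensorProduct.rid k V).toLinearMap ∘ₗ
      (Coalgebra.counit (R := k) (A := H)).lTensor V) x y
  map_smul' a := fun (y : V ⊗[k] H) => by
    have key (x : A ⊗[k] H) :
        TensorProduct.rid k V ((Coalgebra.counit (R := k) (A := H)).lTensor V
          (diagAct k H A V x y)) =
        TensorProduct.rid k A ((Coalgebra.counit (R := k) (A := H)).lTensor A x) •
        TensorProduct.rid k V ((Coalgebra.counit (R := k) (A := H)).lTensor V y) := by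
      induction x with
      | zero => simp
      | add x x' hx hx' => simp only [map_add, LinearMap.add_apply, hx, hx', add_smul]
      | tmul b h =>
        induction y with
        | zero => simp
        | add y y' hy hy' => simp only [map_add, hy, hy', smul_add]
        | tmul v h' =>
          simp only [diagAct_tmul, LinearMap.lTensor_tmul, Bialgebra.counit_mul,
            TensorProduct.rid_tmul, mul_smul, smul_assoc]
          rw [smul_algebra_smul_comm (Coalgebra.counit (R := k) h') b v]
    refine (key (coact k H a)).trans ?_
    rw [RightComodule.counit]
    rfl

variable {V}

/-- The morphism `m ↦ φ(m₀) ⊗ m₁` into the cofree relative Hopf module. -/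
def cofreeLift (φ : M →ₗ[A] V) : M ⟶ cofree k H A V :=
  ofLin
    { toFun := fun m => ((φ.restrictScalars k).rTensor H (coact k H m) : V ⊗[k] H)
      map_add' := fun m m' => by
        rw [map_add, map_add]
        rfl
      map_smul' := fun a m => by
        rw [IsRelHopf.coact_smul, rTensor_diagAct]
        rfl }
    fun m => by
      change (TensorProduct.assoc k V H H).symm ((Coalgebra.comul (R := k) (A := H)).lTensor V
        ((φ.restrictScalars k).rTensor H (coact k H m))) =
          ((φ.restrictScalars k).rTensor H ∘ₗ coact k H).rTensor H (coact k H m)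
      rw [LinearEquiv.symm_apply_eq, LinearMap.rTensor_comp, LinearMap.comp_apply, ← assoc_rTensor,
        RightComodule.coassoc, ← LinearMap.comp_apply (LinearMap.lTensor V _),
        LinearMap.lTensor_comp_rTensor, ← LinearMap.rTensor_comp_lTensor, LinearMap.comp_apply]

theorem cofreeCounit_lift (φ : M →ₗ[A] V) (m : M) :
    cofreeCounit k H A V (Hom.lin (cofreeLift φ) m) = φ m := by
  change TensorProduct.rid k V ((Coalgebra.counit (R := k) (A := H)).lTensor V
        ((φ.restrictScalars k).rTensor H (coact k H m))) = φ m
  rw [← LinearMap.comp_apply (LinearMap.lTensor V _),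
        LinearMap.lTensor_comp_rTensor, ← LinearMap.rTensor_comp_lTensor, LinearMap.comp_apply,
        ← rid_rTensor, RightComodule.counit]
  rfl

theorem cofreeLift_counit (g : M ⟶ cofree k H A V) :
    cofreeLift (cofreeCounit k H A V ∘ₗ Hom.lin g) = g := by
  refine hom_ext' fun m => ?_
  have e : ((cofreeCounit k H A V ∘ₗ Hom.lin g).restrictScalars k) =
    (cofreeCounit k H A V).restrictScalars k ∘ₗ (Hom.lin g).restrictScalars k := rfl
  change LinearMap.rTensor H _ (coact k H m) = Hom.lin g m
  rw [e, LinearMap.rTensor_comp, LinearMap.comp_apply, ← Hom.colinear]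
  have key (x : V ⊗[k] H) : (((TensorProduct.rid k V).toLinearMap ∘ₗ
      (Coalgebra.counit (R := k) (A := H)).lTensor V).rTensor H)
      ((TensorProduct.assoc k V H H).symm ((Coalgebra.comul (R := k) (A := H)).lTensor V x)) =
      x := by
    induction x with
    | zero => simp
    | add x y hx hy => simp only [map_add, hx, hy]
    | tmul v h =>
      have e1 (c : H ⊗[k] H) : (((TensorProduct.rid k V).toLinearMap ∘ₗ
          (Coalgebra.counit (R := k) (A := H)).lTensor V).rTensor H)
          ((TensorProduct.assoc k V H H).symm (v ⊗ₜ c)) = v ⊗ₜ TensorProduct.lid k H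
            ((Coalgebra.counit (R := k) (A := H)).rTensor H c) := by
        induction c with
        | zero => simp
        | add x y hx hy => simp only [map_add, TensorProduct.tmul_add, hx, hy]
        | tmul a b => simp [TensorProduct.smul_tmul]
      rw [LinearMap.lTensor_tmul, e1, Coalgebra.rTensor_counit_comul]
      simp
  exact key _

theorem injective_cofree (hV : Module.Injective A V) :
    Injective (cofree k H A V) where
  factors {X Y} g f _ := by
    obtain ⟨φ, hφ⟩ := hV.out (Hom.lin f) (injective_of_mono f)
      (cofreeCounit k H A V ∘ₗ Hom.lin g)
    refine ⟨cofreeLift φ, ?_⟩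
    have h1 : cofreeCounit k H A V ∘ₗ Hom.lin (f ≫ cofreeLift φ) =
        cofreeCounit k H A V ∘ₗ Hom.lin g := LinearMap.ext fun x =>
      (cofreeCounit_lift φ (Hom.lin f x)).trans (hφ x)
    rw [← cofreeLift_counit (f ≫ cofreeLift φ), h1, cofreeLift_counit]

end Cofree

/-- Over a field, the category of relative Hopf modules has enough injectives. -/
instance : EnoughInjectives (RelHopfModule k H A) where
  presentation M := by
    let J : ModuleCat.{u} A := Injective.under (ModuleCat.of A M)
    let i : M →ₗ[A] J := (Injective.ι (ModuleCat.of A M)).hom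
    have hi : Function.Injective i :=
      (ModuleCat.mono_iff_injective (Injective.ι (ModuleCat.of A M))).1 inferInstance
    have : Injective (ModuleCat.of A J) :=
      Injective.injective_under (ModuleCat.of A M)
    have hJ : Module.Injective A J := Module.injective_module_of_injective_object A J
    let _ : Module k J := Module.compHom J (algebraMap k A)
    have : IsScalarTower k A J := IsScalarTower.of_algebraMap_smul fun _ _ => rfl
    exact ⟨{
      J := cofree k H A J
      injective := injective_cofree hJ
      f := cofreeLift i
      mono := mono_of_injective _ fun x y h => hi (by
        rw [← cofreeCounit_lift (k := k) (H := H) i x, h, cofreeCounit_lift]) }⟩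

end Field

section Hopf

variable {k H A : Type u} [CommRing k] [CommRing H] [CommRing A] [Algebra k A]

/-- The relative Hopf module `M ⊗_A N`, with coaction `m ⊗ n ↦ m₀ ⊗ n₀ ⊗ m₁n₁`. -/
def tensor [Bialgebra k H] [ComoduleAlgebra k H A] (M N : RelHopfModule k H A) : RelHopfModule k H A :=
  letI := RightComodule.tensor k H A M N
  { carrier := M ⊗[A] N
    isRelHopf := isRelHopf_tensor k H A M N }

/-- The relative Hopf module `Hom_A(N, P)`, for `N` finitely generated projective over `A`,
with the coaction determined by `f₀(n) ⊗ f₁ = f(n₀)₀ ⊗ S⁻¹(n₁) f(n₀)₁`. -/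
def ihom [HopfAlgebra k H] [ComoduleAlgebra k H A] (N P : RelHopfModule k H A) [Module.Finite A N] [Module.Projective A N] :
    RelHopfModule k H A :=
  letI := RightComodule.ihom k H A N P
  { carrier := N →ₗ[A] P
    isRelHopf := isRelHopf_ihom k H A N P }

end Hopf

section Ext

variable {k H A : Type u} [Field k] [CommRing H] [Bialgebra k H]
    [CommRing A] [Algebra k A] [ComoduleAlgebra k H A]

/-- The functors `Ext^i(M, -)` on the category of relative Hopf modules: the right derived functors
of the functor `Hom(M, -)` from relative Hopf modules to `k`-modules. -/
def extFunctor (M : RelHopfModule k H A) (i : ℕ) : RelHopfModule k H A ⥤ ModuleCat.{u} k :=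
  ((linearCoyoneda k (RelHopfModule k H A)).obj (Opposite.op M)).rightDerived i

end Ext

end RelHopfModule
end

/-! The functor `Hom_A(N, -)` on relative Hopf modules is exact, preserves injectives and is right
adjoint to `- ⊗_A N`. Hence an injective resolution `I` of `P` gives an injective resolution
`Hom_A(N, I)` of `Hom_A(N, P)`. The adjunction, being `k`-linear and natural in the last variable,
identifies the complexes obtained by applying `Hom(M, -)` to `Hom_A(N, I)` and `Hom(M ⊗_A N, -)` to
`I`; their cohomology is the two sides of the claim. `Functor.rightDerivedObjIsoOfCompIso` is this
argument for general abelian categories.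

Exactness and preservation of injectives are formal once the adjunction is known. A right adjoint
preserves kernels, and projectivity of `N` gives epimorphisms. Injectives are preserved because the
left adjoint preserves monomorphisms, `N` being flat.

The real content is `ihomCoact_colinear_iff`: currying matches colinear maps with colinear maps. For
`φ : N → P ⊗ H` and `g : H → H` put `(φ * g)(n) = (1 ⊗ g(n₁)) φ(n₀)`. This makes the `k`-linear maps
`N → P ⊗ H` a right module over the convolution algebra of `k`-linear endomorphisms of `H`
(`mulMap_mulMap_coact`, `mulMap_counit_coact`), in which the antipode `S` and the identity are
mutually inverse (`mulMap_antipode_eq_iff`). As `H` is commutative, `S⁻¹ = S`, so the coaction of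
`Hom_A(N, P)` sends `f` to `(ρ ∘ f) * S`, read through the bijection `evalHom`, which is where `N`
has to be finitely generated projective. Colinearity of `f : M → Hom_A(N, P)` at `m` then says `(ρ ∘
f(m)) * S = ψ`, where `ψ(n) = f(m₀)(n) ⊗ m₁`. Convolving with the identity turns this into
`ρ(f(m)(n)) = f(m₀)(n₀) ⊗ m₁n₁`, the colinearity of the uncurried map on `m ⊗ n`. -/

open RightComodule (coact)

noncomputable section

/-! ### Derived functors and exact functors that preserve injectives -/

namespace CategoryTheory

section

variable {C D E : Type*} [Category* C] [Category* D] [Category* E]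
  [Abelian C] [Abelian D] [Abelian E]

/-- An exact functor preserving injective objects maps injective resolutions to injective
resolutions. -/
def InjectiveResolution.mapOfPreservesInjectives {X : C} (I : InjectiveResolution X)
    (G : C ⥤ D) [G.Additive] [G.PreservesHomology] [G.PreservesInjectiveObjects] :
    InjectiveResolution (G.obj X) where
  cocomplex := (G.mapHomologicalComplex _).obj I.cocomplex
  injective n := inferInstanceAs (Injective (G.obj (I.cocomplex.X n)))
  ι := (HomologicalComplex.singleMapHomologicalComplex G (ComplexShape.up ℕ) 0).inv.app X ≫
    (G.mapHomologicalComplex _).map I.ι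
  -- The first factor of `ι` is an isomorphism; the second is a quasi-isomorphism because `G`
  -- preserves homology.
  quasiIso := inferInstance

/-- Derived functors of a composition `G ⋙ F`, where `G` is exact and preserves injectives. -/
def Functor.rightDerivedObjIsoOfCompIso [HasInjectiveResolutions C]
    [HasInjectiveResolutions D] (G : C ⥤ D) [G.Additive] [G.PreservesHomology]
    [G.PreservesInjectiveObjects] (F : D ⥤ E) [F.Additive] (F' : C ⥤ E) [F'.Additive]
    (e : G ⋙ F ≅ F') (X : C) (n : ℕ) :
    (F.rightDerived n).obj (G.obj X) ≅ (F'.rightDerived n).obj X :=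
  -- One resolution computes both sides: `I` itself for `F'`, and its image under `G` for `F`. The
  -- two resulting complexes are isomorphic degreewise through `e`, and naturality of `e` gives
  -- compatibility with the differentials.
  let I := injectiveResolution X
  (I.mapOfPreservesInjectives G).isoRightDerivedObj F n ≪≫
    (HomologicalComplex.homologyFunctor E _ n).mapIso
      (show (F.mapHomologicalComplex _).obj ((G.mapHomologicalComplex _).obj I.cocomplex) ≅
          (F'.mapHomologicalComplex _).obj I.cocomplex from
        HomologicalComplex.Hom.isoOfComponents (fun i => e.app (I.cocomplex.X i))
          fun i j _ => (e.hom.naturality (I.cocomplex.d i j)).symm) ≪≫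
    (I.isoRightDerivedObj F' n).symm

end

end CategoryTheory

/-! ### The convolution action on maps from a comodule to `P ⊗ H` -/

section ConvolutionAct

variable {k H : Type*} [CommRing k] [CommRing H]
variable {N P : Type*} [AddCommGroup N] [Module k N] [AddCommGroup P] [Module k P]

/-- The map `n ⊗ h ↦ g(h) φ(n)` from `N ⊗ H` to `P ⊗ H`. -/
def mulMap [HopfAlgebra k H] (φ : N →ₗ[k] P ⊗[k] H) (g : H →ₗ[k] H) : N ⊗[k] H →ₗ[k] P ⊗[k] H :=
  mulLast k H ∘ₗ TensorProduct.map φ g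

theorem mulMap_tmul [HopfAlgebra k H] (φ : N →ₗ[k] P ⊗[k] H) (g : H →ₗ[k] H) (n : N) (h : H) :
    mulMap φ g (n ⊗ₜ h) = mulLast k H (φ n ⊗ₜ g h) := rfl

/-- Commutativity of `H` allows multiplication on the last factor to be treated as a right action,
in the order in which coassociativity produces the factors below. -/
theorem mulLast_mulLast [HopfAlgebra k H] (x : P ⊗[k] H) (h h' : H) :
    mulLast k H (mulLast k H (x ⊗ₜ h) ⊗ₜ h') = mulLast k H (x ⊗ₜ (h * h')) := by
  induction x with
  | zero => simp
  | add x y hx hy => simp only [TensorProduct.add_tmul, map_add, hx, hy]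
  | tmul p c =>
    simp only [mulLast_tmul]
    congr 1
    ring

variable [HopfAlgebra k H] [RightComodule k H N]

/-- Associativity of the convolution action, `(φ * g) * g' = φ * (g * g')`. It is coassociativity of
`N` combined with associativity of the action of `H` on `P ⊗ H`. -/
theorem mulMap_mulMap_coact (φ : N →ₗ[k] P ⊗[k] H) (g g' : H →ₗ[k] H) (n : N) :
    mulMap (mulMap φ g ∘ₗ coact k H) g' (coact k H n) =
      mulMap φ (LinearMap.mul' k H ∘ₗ TensorProduct.map g g' ∘ₗ Coalgebra.comul)
        (coact k H n) := by
  have e : mulMap (mulMap φ g ∘ₗ coact k H) g' =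
      mulMap (mulMap φ g) g' ∘ₗ (coact k H : N →ₗ[k] _).rTensor H :=
    TensorProduct.ext' fun _ _ => rfl
  -- Inserting the associator and its inverse exposes the left side of coassociativity. Afterwards
  -- only one coaction of `n` remains, so it can be replaced by an arbitrary element of `N ⊗ H` and
  -- the claim checked on pure tensors.
  rw [e, LinearMap.comp_apply, ← (TensorProduct.assoc k N H H).symm_apply_apply
    (LinearMap.rTensor _ _ _), RightComodule.coassoc]
  induction (coact k H n : N ⊗[k] H) with
  | zero => simp
  | add x y hx hy => simp only [map_add, hx, hy]
  | tmul n h =>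
    rw [LinearMap.lTensor_tmul, mulMap_tmul, LinearMap.comp_apply, LinearMap.comp_apply]
    induction Coalgebra.comul (R := k) h with
    | zero => simp
    | add x y hx hy => simp only [TensorProduct.tmul_add, map_add, hx, hy]
    | tmul a b => simp [mulMap_tmul, mulLast_mulLast]

/-- The convolution unit `h ↦ ε(h)1` acts trivially, by the counit axiom of `N`. -/
theorem mulMap_counit_coact (φ : N →ₗ[k] P ⊗[k] H) (n : N) :
    mulMap φ (Algebra.linearMap k H ∘ₗ Coalgebra.counit) (coact k H n) = φ n := by
  have e (y : N ⊗[k] H) : mulMap φ (Algebra.linearMap k H ∘ₗ Coalgebra.counit) y =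
      φ (TensorProduct.rid k N ((Coalgebra.counit (R := k) (A := H)).lTensor N y)) := by
    induction y with
    | zero => simp
    | add x y hx hy => simp only [map_add, hx, hy]
    | tmul n h =>
      have e1 (x : P ⊗[k] H) : mulLast k H (x ⊗ₜ 1) = x := by
        induction x with
        | zero => simp
        | add x y hx hy => simp only [TensorProduct.add_tmul, map_add, hx, hy]
        | tmul p c => simp
      simp [mulMap_tmul, Algebra.algebraMap_eq_smul_one, e1]
  rw [e, RightComodule.counit]

/-- Multiplication by the antipode is inverse to multiplication by the identity, on maps
`N → P ⊗ H`. -/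
theorem mulMap_antipode_eq_iff (φ ψ : N →ₗ[k] P ⊗[k] H) :
    mulMap φ (HopfAlgebra.antipode k) ∘ₗ coact k H = ψ ↔
      φ = mulMap ψ LinearMap.id ∘ₗ coact k H := by
  constructor
  -- Here `(φ * S) * id = φ * (S * id)`, and `S(h₁)h₂ = ε(h)1`.
  · rintro rfl
    ext n : 1
    rw [LinearMap.comp_apply, mulMap_mulMap_coact]
    refine (mulMap_counit_coact φ n).symm.trans ?_
    congr 2
    ext h
    exact (HopfAlgebra.mul_antipode_rTensor_comul_apply h).symm
  -- Here `(ψ * id) * S = ψ * (id * S)`, and `h₁S(h₂) = ε(h)1`.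
  · rintro rfl
    ext n : 1
    rw [LinearMap.comp_apply, mulMap_mulMap_coact]
    refine Eq.trans ?_ (mulMap_counit_coact ψ n)
    congr 2
    ext h
    exact HopfAlgebra.mul_antipode_lTensor_comul_apply h

end ConvolutionAct

/-! ### Currying and colinearity -/

section CurryColinear

variable {k H A : Type*} [CommRing k] [CommRing H] [HopfAlgebra k H] [CommRing A] [Algebra k A]
variable {M N P : Type*} [AddCommGroup M] [Module k M] [Module A M] [IsScalarTower k A M]
  [AddCommGroup N] [Module k N] [Module A N] [IsScalarTower k A N]
  [AddCommGroup P] [Module k P] [Module A P] [IsScalarTower k A P]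

/-- With `x = ρ(m)` and `y = ρ(n)`, both sides are `f(m₀)(n₀) ⊗ m₁n₁`. This recognises the
colinearity condition on `M ⊗_A N` as a convolution with the identity of `H`, the form needed for
`mulMap_antipode_eq_iff`. -/
theorem lift_rTensor_tensorMul (f : M →ₗ[A] N →ₗ[A] P) (x : M ⊗[k] H) (y : N ⊗[k] H) :
    ((TensorProduct.lift f).restrictScalars k).rTensor H (tensorMul k H A M N x y) =
      mulMap ((evalHom k A N P H ((f.restrictScalars k).rTensor H x)).restrictScalars k)
        LinearMap.id y := by
  induction y with
  | zero => simp
  | add y y' hy hy' => simp only [map_add, hy, hy']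
  | tmul n h =>
    rw [mulMap_tmul]
    induction x with
    | zero => simp
    | add x x' hx hx' =>
      simp only [map_add, LinearMap.add_apply, LinearMap.restrictScalars_add,
        TensorProduct.add_tmul, hx, hx']
    | tmul m h' => simp [mul_comm]

variable [ComoduleAlgebra k H A] [RightComodule k H M] [RightComodule k H N] [RightComodule k H P]
  [IsRelHopf k H A M] [IsRelHopf k H A N] [IsRelHopf k H A P]
  [Module.Finite A N] [Module.Projective A N]

/-- Under the adjunction between `M ⊗_A N` and `Hom_A(N, P)`, colinear maps correspond to
colinear maps. -/
theorem ihomCoact_colinear_iff (f : M →ₗ[A] N →ₗ[A] P) :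
    (∀ m, ihomCoact k H A N P (f m) = (f.restrictScalars k).rTensor H (coact k H m)) ↔
      ∀ x, coact k H (TensorProduct.lift f x) =
        ((TensorProduct.lift f).restrictScalars k).rTensor H (tensorCoact k H A M N x) := by
  -- The equivalence already holds for each `m` separately, provided `n` ranges over all of `N`:
  -- inverting the antipode mixes the values at different `n`, but leaves `m` alone.
  have h (m : M) : ihomCoact k H A N P (f m) = (f.restrictScalars k).rTensor H (coact k H m) ↔
      ∀ n, coact k H (f m n) = ((TensorProduct.lift f).restrictScalars k).rTensor H
        (tensorCoact k H A M N (m ⊗ₜ n)) := by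
    rw [← (evalHom_bijective k A N P H).injective.eq_iff, evalHom_ihomCoact]
    -- Take `φ = ρ ∘ f(m)` and `ψ(n) = f(m₀)(n) ⊗ m₁`.
    have h1 := mulMap_antipode_eq_iff (coact k H ∘ₗ (f m).restrictScalars k)
      ((evalHom k A N P H ((f.restrictScalars k).rTensor H (coact k H m))).restrictScalars k)
    rw [LinearMap.ext_iff, LinearMap.ext_iff] at h1
    rw [LinearMap.ext_iff]
    -- The twist is written with the inverse antipode, which `antipodeEquiv` defines to be the
    -- antipode itself; hence the left side of `h1` agrees with the goal by definition.
    refine h1.trans (forall_congr' fun n => ?_)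
    rw [tensorCoact_tmul, lift_rTensor_tensorMul]
    rfl
  constructor
  · intro hf x
    induction x with
    | zero => simp
    | add x y hx hy => simp only [map_add, hx, hy]
    | tmul m n => exact (h m).1 (hf m) n
  · exact fun hf m => (h m).2 fun n => hf (m ⊗ₜ n)

end CurryColinear

/-! ### The adjunction between `- ⊗_A N` and `Hom_A(N, -)` -/

namespace RelHopfModule

section Functors

variable {k H A : Type u} [CommRing k] [CommRing H] [CommRing A] [Algebra k A]

/-- The functor `- ⊗_A N` on relative Hopf modules. -/
def tensorRight [Bialgebra k H] [ComoduleAlgebra k H A] (N : RelHopfModule k H A) :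
    RelHopfModule k H A ⥤ RelHopfModule k H A where
  obj M := tensor M N
  map {M M'} f := ofLin (M := tensor M N) (N := tensor M' N) ((Hom.lin f).rTensor N)
    fun (x : M ⊗[A] N) => by
      change tensorCoact k H A M' N ((Hom.lin f).rTensor N x) =
        (((Hom.lin f).rTensor N).restrictScalars k).rTensor H (tensorCoact k H A M N x)
      -- Naturality of the product `(m ⊗ h, n ⊗ h') ↦ (m ⊗ n) ⊗ hh'` in `M`; colinearity of `f` then
      -- suffices on pure tensors.
      have key (y : M ⊗[k] H) (z : N ⊗[k] H) :
          tensorMul k H A M' N (((Hom.lin f).restrictScalars k).rTensor H y) z =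
          (((Hom.lin f).rTensor N).restrictScalars k).rTensor H (tensorMul k H A M N y z) := by
        induction y with
        | zero => simp
        | add y y' hy hy' => simp only [map_add, LinearMap.add_apply, hy, hy']
        | tmul m h =>
          induction z with
          | zero => simp
          | add z z' hz hz' => simp only [map_add, hz, hz']
          | tmul n h' => simp
      induction x with
      | zero => simp
      | add x y hx hy => simp only [map_add, hx, hy]
      | tmul m n =>
        rw [LinearMap.rTensor_tmul, tensorCoact_tmul, tensorCoact_tmul, Hom.colinear, key]
  map_id M := hom_ext' fun x => congr($(LinearMap.rTensor_id (R := A) N M) x)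
  map_comp f g := hom_ext' fun x => congr($(LinearMap.rTensor_comp N (Hom.lin g) (Hom.lin f)) x)

variable [HopfAlgebra k H] [ComoduleAlgebra k H A]
variable (N : RelHopfModule k H A) [Module.Finite A N] [Module.Projective A N]

/-- The functor `Hom_A(N, -)` on relative Hopf modules, for `N` finitely generated projective
over `A`. -/
def ihomFunctor : RelHopfModule k H A ⥤ RelHopfModule k H A where
  obj P := ihom N P
  map {P P'} f := ofLin (M := ihom N P) (N := ihom N P') ((Hom.lin f).compRight A)
    fun (g : N →ₗ[A] P) => by
      change ihomCoact k H A N P' (Hom.lin f ∘ₗ g) =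
        (((Hom.lin f).compRight A).restrictScalars k).rTensor H (ihomCoact k H A N P g)
      -- The coaction on `Hom_A(N, P')` is only known after `evalHom`, so the two sides are compared
      -- as maps `N → P' ⊗ H`.
      apply (evalHom_bijective k A N P' H).injective
      ext n
      have e1 (z : (N →ₗ[A] P) ⊗[k] H) : evalHom k A N P' H
          ((((Hom.lin f).compRight A).restrictScalars k).rTensor H z) n =
          ((Hom.lin f).restrictScalars k).rTensor H (evalHom k A N P H z n) := by
        induction z with
        | zero => simp
        | add x y hx hy => simp only [map_add, LinearMap.add_apply, hx, hy]
        | tmul g h => rfl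
      have e2 (z : P ⊗[k] H) (h : H) :
          mulLast k H (((Hom.lin f).restrictScalars k).rTensor H z ⊗ₜ h) =
          ((Hom.lin f).restrictScalars k).rTensor H (mulLast k H (z ⊗ₜ h)) := by
        induction z with
        | zero => simp
        | add x y hx hy => simp only [TensorProduct.add_tmul, map_add, hx, hy]
        | tmul p h => simp
      rw [e1, evalHom_ihomCoact, evalHom_ihomCoact, twist_apply, twist_apply]
      -- The twist is natural in `P` even before `ρ(n)` is substituted. On a pure tensor `n ⊗ h`
      -- what remains is colinearity of `f` at `g n`.
      induction (coact k H n : N ⊗[k] H) with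
      | zero => simp
      | add x y hx hy => simp only [map_add, hx, hy]
      | tmul n h =>
        rw [twistAux_tmul, twistAux_tmul, ← e2]
        exact congrArg (fun z => mulLast k H (z ⊗ₜ _)) (Hom.colinear f (g n))
  map_id _ := rfl
  map_comp _ _ := rfl

variable (M P : RelHopfModule k H A)

/-- Currying, as a `k`-linear isomorphism between spaces of morphisms of relative Hopf modules. -/
def curryEquiv : (tensor M N ⟶ P) ≃ₗ[k] (M ⟶ ihom N P) where
  toFun g := ofLin (N := ihom N P) (TensorProduct.curry (Hom.lin g))
    ((ihomCoact_colinear_iff _).2 fun x => by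
      rw [show TensorProduct.lift (TensorProduct.curry (Hom.lin g)) = Hom.lin g from
        TensorProduct.ext' fun _ _ => rfl]
      exact Hom.colinear g x)
  map_add' _ _ := rfl
  map_smul' _ _ := rfl
  invFun f := ofLin (M := tensor M N) (TensorProduct.lift (Hom.lin f))
    ((ihomCoact_colinear_iff (Hom.lin f)).1 (Hom.colinear f))
  left_inv g := Subtype.ext (TensorProduct.ext' fun _ _ => rfl)
  right_inv f := Subtype.ext (LinearMap.ext fun _ => LinearMap.ext fun _ => rfl)

/-- The functor `- ⊗_A N` is left adjoint to `Hom_A(N, -)`. -/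
def tensorRightAdjunction : tensorRight N ⊣ ihomFunctor N :=
  Adjunction.mkOfHomEquiv
    { homEquiv := fun M P => (curryEquiv N M P).toEquiv
      homEquiv_naturality_left_symm := fun _ _ =>
        Subtype.ext (TensorProduct.ext' fun _ _ => rfl)
      homEquiv_naturality_right := fun _ _ => rfl }

instance : (ihomFunctor N).Additive where
  map_add := rfl

/-- The adjunction isomorphism as an isomorphism of functors to `k`-modules. -/
def ihomCompCoyonedaIso :
    ihomFunctor N ⋙ (linearCoyoneda k (RelHopfModule k H A)).obj (Opposite.op M) ≅
      (linearCoyoneda k (RelHopfModule k H A)).obj (Opposite.op (tensor M N)) :=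
  -- The inverse of currying is used because the isomorphism starts from maps into `Hom_A(N, P)`;
  -- naturality in `P` is checked on pure tensors.
  NatIso.ofComponents (fun P => (curryEquiv N M P).symm.toModuleIso) fun f => by
    ext g
    exact Subtype.ext (TensorProduct.ext' fun _ _ => rfl)

end Functors

/-! ### Exactness of `Hom_A(N, -)` and preservation of injectives -/

section Field

variable {k H A : Type u} [Field k] [CommRing H] [HopfAlgebra k H]
    [CommRing A] [Algebra k A] [ComoduleAlgebra k H A]
-- Over a field, kernels are computed on underlying modules, so monomorphisms are injective maps;
-- these stay injective after tensoring with `N`, which is flat because it is projective.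
theorem tensorRight_preservesMonomorphisms (N : RelHopfModule k H A) [Module.Projective A N] :
    (tensorRight N).PreservesMonomorphisms where
  preserves f _ := mono_of_injective _
    (Module.Flat.rTensor_preserves_injective_linearMap (Hom.lin f) (injective_of_mono f))

variable (N : RelHopfModule k H A) [Module.Finite A N] [Module.Projective A N]

/-- A right adjoint preserves injectives as soon as its left adjoint preserves monomorphisms. -/
instance : (ihomFunctor N).PreservesInjectiveObjects where
  injective_obj hX :=
    have := tensorRight_preservesMonomorphisms N
    (tensorRightAdjunction N).map_injective _ hX

/-- Epimorphisms are surjective, so projectivity of `N` lifts every `A`-linear map. The lift need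
not be colinear: surjectivity concerns the elements of `Hom_A(N, P)`, which are all the `A`-linear
maps. -/
instance : (ihomFunctor N).PreservesEpimorphisms where
  preserves f _ := epi_of_surjective _ fun (g : N →ₗ[A] _) =>
    Module.projective_lifting_property (Hom.lin f) g (surjective_of_epi f)

/-- Kernels are preserved by a right adjoint; together with epimorphisms this is exactness. -/
instance : (ihomFunctor N).PreservesHomology :=
  have := (tensorRightAdjunction N).rightAdjoint_preservesLimits
  Functor.preservesHomology_of_preservesEpis_and_kernels _

end Field

end RelHopfModule

end

theorem proposition3p2 {k H A : Type u} [Field k] [CommRing H] [HopfAlgebra k H]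
    [CommRing A] [Algebra k A] [ComoduleAlgebra k H A]
    (M N P : RelHopfModule k H A) [Module.Finite A N] [Module.Projective A N] (i : ℕ) :
    Nonempty ((RelHopfModule.extFunctor M i).obj (RelHopfModule.ihom N P) ≅
      (RelHopfModule.extFunctor (RelHopfModule.tensor M N) i).obj P) :=
  -- The two omitted functors are `Hom(M, -)` and `Hom(M ⊗_A N, -)` with values in `k`-modules,
  -- determined by the adjunction isomorphism.
  ⟨Functor.rightDerivedObjIsoOfCompIso (RelHopfModule.ihomFunctor N) _ _
    (RelHopfModule.ihomCompCoyonedaIso N M) P i⟩
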